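/- Let $d,m\ge 0$ be integers and let $\|\cdot\|$ be a strictly convex norm on $\mathbb{R}^d$, that is, $\|x+y\|<\|x\|+\|y\|$ whenever $x,y\neq 0$ and $x\neq ty$ for all $t\in\mathbb{R}$. Let $\mathcal{H}^m$ and $H^m$ denote the $m$-dimensional Hausdorff measures on $\mathbb{R}^d$ built from $\|\cdot\|$ and from the Euclidean norm $\|\cdot\|_2$ respectively, both normalised by $\sum_i(\operatorname{diam}U_i)^m$ (no dimensional constant). Let $B(a,r)=\{x:\|x-a\|<r\}$ and $B_2(a,r)=\{x:\|x-a\|_2<r\}$. Let $E\subset\mathbb{R}^d$ be $m$-regular in $(\mathbb{R}^d,\|\cdot\|)$: $E$ is $\mathcal{H}^m$-measurable, $\mathcal{H}^m(E)<\infty$, and $$\lim_{r\to0^+}\frac{\mathcal{H}^m(E\cap B(a,r))}{(2r)^m}=1\qquad\text{for }\mathcal{H}^m\text{-almost every }a\in E.$$ Then, for $\mathcal{H}^m$-almost every $a\in E$, $$\liminf_{r\to0^+}\ \sup_{V\in A(a,d,m)}\frac{H^m\big(P_V[E\cap B_2(a,r)]\big)}{(2r)^m}\ \ge\ 1,$$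 where $A(a,d,m)$ is the set of $m$-dimensional affine subspaces of $\mathbb{R}^d$ containing $a$ and $P_V$ is the Euclidean orthogonal projection onto $V$. -/

import Mathlib

open MeasureTheory Measure Filter Topology
open scoped ENNReal

noncomputable section

/-- A set `E` in a normed space is `m`-regular if it is `H^m`-measurable, has finite `H^m`-measure,
and its `m`-density `lim_{r → 0+} H^m(E ∩ B(a, r)) / (2r)^m` exists and equals `1` at
`H^m`-almost every `a ∈ E`. Here `μH[m]` is the Hausdorff measure of the metric of `X`, normalised
by `∑ (diam U_i)^m`; for sets of finite measure, Carathéodory measurability with respect to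
`H^m` is the same as null-measurability. -/
structure IsRegularSet {X : Type*} [NormedAddCommGroup X] [MeasurableSpace X] [BorelSpace X]
    (m : ℕ) (E : Set X) : Prop where
  nullMeasurableSet : NullMeasurableSet E (μH[(m : ℝ)] : Measure X)
  measure_lt_top : (μH[(m : ℝ)] : Measure X) E < ∞
  density_eq_one : ∀ᵐ a ∂(μH[(m : ℝ)] : Measure X), a ∈ E →
    Tendsto
      (fun r : ℝ => (μH[(m : ℝ)] : Measure X) (E ∩ Metric.ball a r) / ENNReal.ofReal (2 * r) ^ m)
      (𝓝[>] 0) (𝓝 1)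

/-- `A(a, d, m)`: the `m`-dimensional affine subspaces of Euclidean `ℝ^d` that contain `a`. -/
def PlanesThrough {d : ℕ} (a : EuclideanSpace ℝ (Fin d)) (m : ℕ) : Type :=
  {V : AffineSubspace ℝ (EuclideanSpace ℝ (Fin d)) // a ∈ V ∧ Module.finrank ℝ V.direction = m}

/-- Euclidean orthogonal projection `P_V` onto a plane `V ∈ A(a, d, m)`, as a self-map of `ℝ^d`. -/
def PlanesThrough.proj {d : ℕ} {a : EuclideanSpace ℝ (Fin d)} {m : ℕ} (V : PlanesThrough a m)
    (x : EuclideanSpace ℝ (Fin d)) : EuclideanSpace ℝ (Fin d) :=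
  haveI : Nonempty V.1 := ⟨⟨a, V.2.1⟩⟩
  (EuclideanGeometry.orthogonalProjection V.1 x : EuclideanSpace ℝ (Fin d))

end

/-! ### The isodiametric inequality -/

/-! Let `μ` be the Hausdorff measure of `X` restricted to `E`. The proof shows that regularity in a
strictly convex norm forces `E` to be flat at small scales, and then that flatness forces large
projections.

Flatness. Besides ball density one, a Vitali argument gives almost everywhere upper convex density
at most one (`measure_convexDensityExceeds_eq_zero`): small sets of diameter `D` have mass at most
about `D ^ m`. An Egorov argument makes these bounds uniform on a compact `F`, with `F` of uniformly
full density at a compact `F' ⊆ F` (`exists_isCompact_hasUniformDensity`). Blow up at points of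
`F'`. If `y`, `z` lie in the limit set and `ρ = ‖y - z‖`, a ball about `y` of radius slightly below
`ρ` already has the mass its diameter allows; a small disjoint ball about `z` adds mass, so the
union must have larger diameter. In the limit this yields a point `q` with `‖q - y‖ ≤ ρ` and `‖q -
z‖ ≥ 2ρ`. By strict convexity `q = 2y - z`, so the limit set is symmetric about each of its points.
Being closed with `m`-dimensional packing and covering numbers, it is an `m`-dimensional subspace
(`exists_submodule_eq_of_reflection`). Compactness turns this into `IsFlatAt`, an affine notion that
survives the passage to Euclidean coordinates.

Projection. Near a density point `a` of `K`, the image of `F'`, project onto the plane `V`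
approximating the image of `F` at scale `r`. A missed point of `V` lies either in a disc over which
a steep chord stacks about `N` times the normal mass, or in a disc over which the complement of `K`
has definite mass (`exists_disc_of_notMem_projection`). By a Vitali covering of `V` both kinds of
disc cover little. What remains is almost a whole disc, of measure at least `(2R) ^ m` by the
Euclidean isodiametric inequality. The sharp constant enters only here, so the distortion between
the two norms is harmless. -/

/-- Steiner symmetrization of `A` with respect to the `i`-th coordinate hyperplane. -/
def steinerSymm {ι : Type*} [DecidableEq ι] (i : ι) (A : Set (ι → ℝ)) : Set (ι → ℝ) :=
  {x | ENNReal.ofReal (2 * |x i|) < volume {t : ℝ | Function.update x i t ∈ A}}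

section Steiner

variable {ι : Type*} [DecidableEq ι]

theorem measurable_volume_fiber [Fintype ι] (i : ι) {A : Set (ι → ℝ)} (hA : MeasurableSet A) :
    Measurable fun x : ι → ℝ => volume {t : ℝ | Function.update x i t ∈ A} := by
  have h := (measurable_one.indicator hA : Measurable (A.indicator (1 : (ι → ℝ) → ℝ≥0∞))).lmarginal
    (fun _ : ι => (volume : Measure ℝ)) (s := {i})
  rw [lmarginal_singleton] at h
  convert h using 1
  ext x
  have hm : MeasurableSet {t : ℝ | Function.update x i t ∈ A} := measurable_update x hA
  rw [← lintegral_indicator_one hm]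
  rfl

theorem measurableSet_steinerSymm [Fintype ι] (i : ι) {A : Set (ι → ℝ)} (hA : MeasurableSet A) :
    MeasurableSet (steinerSymm i A) :=
  measurableSet_lt (by fun_prop) (measurable_volume_fiber i hA)

theorem volume_setOf_ofReal_two_mul_abs_lt (L : ℝ≥0∞) :
    volume {t : ℝ | ENNReal.ofReal (2 * |t|) < L} = L := by
  rcases eq_or_ne L ∞ with rfl | hL
  · simp only [ENNReal.ofReal_lt_top, Set.ofPred_true, measure_univ_of_isAddLeftInvariant]
  · have : {t : ℝ | ENNReal.ofReal (2 * |t|) < L} = Metric.ball 0 (L.toReal / 2) := by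
      ext t
      rw [Set.mem_ofPred_eq, ENNReal.ofReal_lt_iff_lt_toReal (by positivity) hL,
        mem_ball_zero_iff, Real.norm_eq_abs]
      constructor <;> intro h <;> linarith
    rw [this, Real.volume_ball, mul_div_cancel₀ _ two_ne_zero, ENNReal.ofReal_toReal hL]

theorem volume_steinerSymm [Fintype ι] (i : ι) {A : Set (ι → ℝ)} (hA : MeasurableSet A) :
    volume (steinerSymm i A) = volume A := by
  have hS := measurableSet_steinerSymm i hA
  rw [← lintegral_indicator_one hS, ← lintegral_indicator_one hA, volume_pi]
  refine lintegral_eq_of_lmarginal_eq {i} (measurable_one.indicator hS) (measurable_one.indicator hA) ?_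
  rw [lmarginal_singleton, lmarginal_singleton]
  ext x
  have hm : MeasurableSet {t : ℝ | Function.update x i t ∈ A} := measurable_update x hA
  have hm' : MeasurableSet {t : ℝ | Function.update x i t ∈ steinerSymm i A} :=
    measurable_update x hS
  have e1 : ∫⁻ t, (steinerSymm i A).indicator (1 : (ι → ℝ) → ℝ≥0∞) (Function.update x i t) =
      volume {t : ℝ | Function.update x i t ∈ steinerSymm i A} := by
    rw [← lintegral_indicator_one hm']; rfl
  have e2 : ∫⁻ t, A.indicator (1 : (ι → ℝ) → ℝ≥0∞) (Function.update x i t) =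
      volume {t : ℝ | Function.update x i t ∈ A} := by
    rw [← lintegral_indicator_one hm]; rfl
  rw [e1, e2]
  simp only [steinerSymm, Set.mem_ofPred_eq, Function.update_idem, Function.update_self]
  exact volume_setOf_ofReal_two_mul_abs_lt _

/-- Each set lies between its infimum and supremum, and each supremum exceeds the infimum of the
other set by at most `c`; adding the two lengths gives `2c`. -/
theorem volume_add_volume_le_of_abs_sub_lt {A B : Set ℝ} (hA : A.Nonempty) (hB : B.Nonempty) {c : ℝ}
    (h : ∀ s ∈ A, ∀ t ∈ B, |s - t| < c) : volume A + volume B ≤ ENNReal.ofReal (2 * c) := by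
  obtain ⟨s₀, hs₀⟩ := hA
  obtain ⟨t₀, ht₀⟩ := hB
  have bA : BddBelow A := ⟨t₀ - c, fun s hs => by linarith [abs_lt.1 (h s hs t₀ ht₀)]⟩
  have bA' : BddAbove A := ⟨t₀ + c, fun s hs => by linarith [abs_lt.1 (h s hs t₀ ht₀)]⟩
  have bB : BddBelow B := ⟨s₀ - c, fun t ht => by linarith [abs_lt.1 (h s₀ hs₀ t ht)]⟩
  have bB' : BddAbove B := ⟨s₀ + c, fun t ht => by linarith [abs_lt.1 (h s₀ hs₀ t ht)]⟩
  have h1 : sSup A ≤ sInf B + c := csSup_le ⟨s₀, hs₀⟩ fun s hs => by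
    rw [← _root_.sub_le_iff_le_add]
    exact le_csInf ⟨t₀, ht₀⟩ fun t ht => by linarith [abs_lt.1 (h s hs t ht)]
  have h2 : sSup B ≤ sInf A + c := csSup_le ⟨t₀, ht₀⟩ fun t ht => by
    rw [← _root_.sub_le_iff_le_add]
    exact le_csInf ⟨s₀, hs₀⟩ fun s hs => by linarith [abs_lt.1 (h s hs t ht)]
  calc volume A + volume B ≤ volume (Set.Icc (sInf A) (sSup A)) + volume (Set.Icc (sInf B) (sSup B)) :=
        add_le_add (measure_mono (subset_Icc_csInf_csSup bA bA'))
          (measure_mono (subset_Icc_csInf_csSup bB bB'))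
    _ = ENNReal.ofReal (sSup A - sInf A + (sSup B - sInf B)) := by
        rw [Real.volume_Icc, Real.volume_Icc, ENNReal.ofReal_add]
        · linarith [csInf_le bA hs₀, le_csSup bA' hs₀]
        · linarith [csInf_le bB ht₀, le_csSup bB' ht₀]
    _ ≤ _ := ENNReal.ofReal_le_ofReal (by linarith)

/-- The fibres over `x` and `y` are longer than `2|x i|` and `2|y i|`, so they contain `s`, `t` with
`|s - t| ≥ |x i| + |y i| ≥ |x i - y i|`. The other coordinates do not change. -/
theorem sum_sq_sub_le_of_mem_steinerSymm [Fintype ι] (i : ι) {A : Set (ι → ℝ)} {D : ℝ}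
    (hA : ∀ x ∈ A, ∀ y ∈ A, ∑ j, (x j - y j) ^ 2 ≤ D) :
    ∀ x ∈ steinerSymm i A, ∀ y ∈ steinerSymm i A, ∑ j, (x j - y j) ^ 2 ≤ D := by
  intro x hx y hy
  simp only [steinerSymm, Set.mem_ofPred_eq] at hx hy
  obtain ⟨s, hs, t, ht, hst⟩ : ∃ s ∈ {t : ℝ | Function.update x i t ∈ A},
      ∃ t ∈ {t : ℝ | Function.update y i t ∈ A}, |x i| + |y i| ≤ |s - t| := by
    by_contra! hcon
    have := volume_add_volume_le_of_abs_sub_lt (nonempty_of_measure_ne_zero hx.ne_bot)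
      (nonempty_of_measure_ne_zero hy.ne_bot) hcon
    rw [mul_add, ENNReal.ofReal_add (by positivity) (by positivity)] at this
    exact (ENNReal.add_lt_add hx hy).not_ge this
  refine le_trans ?_ (hA _ hs _ ht)
  refine Finset.sum_le_sum fun j _ => ?_
  rcases eq_or_ne j i with rfl | hj
  · rw [Function.update_self, Function.update_self, sq_le_sq]
    exact (abs_sub _ _).trans hst
  · rw [Function.update_of_ne hj, Function.update_of_ne hj]

/-- Symmetrizing in a new coordinate keeps the earlier symmetries: reflecting another coordinate
preserves the lengths of the fibres. -/
theorem exists_symmetric_volume_eq [Fintype ι] {A : Set (ι → ℝ)} (hA : MeasurableSet A) {D : ℝ}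
    (hD : ∀ x ∈ A, ∀ y ∈ A, ∑ j, (x j - y j) ^ 2 ≤ D) (s : Finset ι) :
    ∃ B : Set (ι → ℝ), MeasurableSet B ∧ volume B = volume A ∧
      (∀ x ∈ B, ∀ y ∈ B, ∑ j, (x j - y j) ^ 2 ≤ D) ∧
      ∀ j ∈ s, ∀ x ∈ B, Function.update x j (-x j) ∈ B := by
  induction s using Finset.induction_on with
  | empty => exact ⟨A, hA, rfl, hD, by simp⟩
  | insert i s _ ih =>
    obtain ⟨B, hB, hBA, hBD, hBs⟩ := ih
    refine ⟨steinerSymm i B, measurableSet_steinerSymm i hB, (volume_steinerSymm i hB).trans hBA,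
      sum_sq_sub_le_of_mem_steinerSymm i hBD, fun j hj x hx => ?_⟩
    rcases eq_or_ne j i with rfl | hji
    · simpa [steinerSymm] using hx
    · have hjs : j ∈ s := (Finset.mem_insert.1 hj).resolve_left hji
      simp only [steinerSymm, Set.mem_ofPred_eq] at hx ⊢
      rw [Function.update_of_ne hji.symm]
      refine hx.trans_le (measure_mono fun t ht => ?_)
      have := hBs j hjs _ ht
      rwa [Function.update_of_ne hji, Function.update_comm hji.symm] at this

theorem neg_mem_of_forall_update_mem [Fintype ι] {B : Set (ι → ℝ)}
    (hB : ∀ j, ∀ x ∈ B, Function.update x j (-x j) ∈ B) {x : ι → ℝ} (hx : x ∈ B) : -x ∈ B := by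
  have key : ∀ s : Finset ι, (fun j => if j ∈ s then -x j else x j) ∈ B := by
    intro s
    induction s using Finset.induction_on with
    | empty => simpa using hx
    | insert i s his ih =>
      convert hB i _ ih using 1
      ext j
      rcases eq_or_ne j i with rfl | hj
      · simp [his]
      · simp [hj]
  have h := key Finset.univ
  simp only [Finset.mem_univ, if_true] at h
  exact h

end Steiner

/-- The **isodiametric inequality** in Euclidean space. -/
theorem volume_le_volume_closedBall_of_dist_le {m : ℕ} {A : Set (EuclideanSpace ℝ (Fin m))} {D : ℝ}
    (hD : 0 ≤ D) (hA : ∀ x ∈ A, ∀ y ∈ A, dist x y ≤ D) :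
    volume A ≤ volume (Metric.closedBall (0 : EuclideanSpace ℝ (Fin m)) (D / 2)) := by
  have hcl : ∀ x ∈ closure A, ∀ y ∈ closure A, dist x y ≤ D := by
    intro x hx y hy
    have h := map_mem_closure₂ (f := fun x y : EuclideanSpace ℝ (Fin m) => dist x y)
      (by fun_prop) hx hy (u := Set.Iic D) hA
    rwa [isClosed_Iic.closure_eq] at h
  have hvp := PiLp.volume_preserving_toLp (Fin m)
  have key : ∀ x y : Fin m → ℝ, dist (WithLp.toLp 2 x) (WithLp.toLp 2 y) ≤ D ↔
      ∑ j, (x j - y j) ^ 2 ≤ D ^ 2 := by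
    intro x y
    rw [EuclideanSpace.dist_eq, Real.sqrt_le_left hD]
    simp [Real.dist_eq, sq_abs]
  obtain ⟨B, hB, hBA, hBD, hBs⟩ := exists_symmetric_volume_eq
    (hvp.measurable isClosed_closure.measurableSet)
    (fun x hx y hy => (key x y).1 (hcl _ hx _ hy)) Finset.univ
  calc volume A ≤ volume (closure A) := measure_mono subset_closure
    _ = volume B := by
      rw [hBA, hvp.measure_preimage isClosed_closure.measurableSet.nullMeasurableSet]
    _ ≤ volume (WithLp.toLp 2 ⁻¹'
        (Metric.closedBall (0 : EuclideanSpace ℝ (Fin m)) (D / 2))) := by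
      -- Central symmetry of `B` allows the comparison of `x` with `-x`, which bounds `2‖x‖` by `D`.
      refine measure_mono fun x hx => ?_
      have h := (key x (-x)).2 (hBD _ hx _ (neg_mem_of_forall_update_mem (by simpa using hBs) hx))
      have e : WithLp.toLp 2 x - WithLp.toLp 2 (-x) = (2 : ℝ) • WithLp.toLp 2 x := by
        rw [WithLp.toLp_neg]; module
      rw [dist_eq_norm, e, norm_smul, Real.norm_eq_abs, abs_two] at h
      rw [Set.mem_preimage, mem_closedBall_zero_iff]
      linarith
    _ = _ := hvp.measure_preimage Metric.isClosed_closedBall.measurableSet.nullMeasurableSet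

/-- By the isodiametric inequality, Lebesgue measure rescaled to give the unit ball mass `2 ^ m` is
at most `diam ^ m` on every small set, hence lies below the Hausdorff measure. -/
theorem two_pow_le_hausdorffMeasure_closedBall (m : ℕ) :
    (2 : ℝ≥0∞) ^ m ≤ μH[(m : ℝ)] (Metric.closedBall (0 : EuclideanSpace ℝ (Fin m)) 1) := by
  set v := volume (Metric.closedBall (0 : EuclideanSpace ℝ (Fin m)) 1) with hv
  have hv0 : v ≠ 0 := (Metric.measure_closedBall_pos _ _ one_pos).ne'
  have hvt : v ≠ ∞ := measure_closedBall_lt_top.ne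
  have h : (2 ^ m * v⁻¹) • (volume : Measure (EuclideanSpace ℝ (Fin m))) ≤ μH[(m : ℝ)] := by
    refine le_hausdorffMeasure _ _ 1 one_pos fun s hs => ?_
    have hb : Metric.ediam s ≠ ∞ := (hs.trans_lt ENNReal.one_lt_top).ne
    have h1 := volume_le_volume_closedBall_of_dist_le (A := s) (D := Metric.diam s)
      Metric.diam_nonneg
      fun x hx y hy => Metric.dist_le_diam_of_mem (Metric.isBounded_iff_ediam_ne_top.2 hb) hx hy
    rw [addHaar_closedBall' _ _ (by positivity), ← hv, finrank_euclideanSpace_fin] at h1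
    rw [Measure.smul_apply, smul_eq_mul, ENNReal.rpow_natCast]
    have h2 : 2 * ENNReal.ofReal (Metric.diam s / 2) = ENNReal.ofReal (Metric.diam s) := by
      have h3 := ENNReal.ofReal_mul (p := 2) (q := Metric.diam s / 2) zero_le_two
      rwa [mul_div_cancel₀ _ two_ne_zero, ENNReal.ofReal_ofNat, eq_comm] at h3
    calc 2 ^ m * v⁻¹ * volume s
        ≤ 2 ^ m * v⁻¹ * (ENNReal.ofReal ((Metric.diam s / 2) ^ m) * v) := by gcongr
      _ = 2 ^ m * ENNReal.ofReal ((Metric.diam s / 2) ^ m) * (v⁻¹ * v) := by ring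
      _ = Metric.ediam s ^ m := by
        rw [ENNReal.inv_mul_cancel hv0 hvt, mul_one, ENNReal.ofReal_pow (by positivity),
          ← mul_pow, h2, Metric.diam, ENNReal.ofReal_toReal hb]
  refine le_trans ?_ (h _)
  rw [Measure.smul_apply, smul_eq_mul, ← hv, mul_assoc, ENNReal.inv_mul_cancel hv0 hvt, mul_one]

/-- An `m`-dimensional closed Euclidean ball of radius `R` has `m`-dimensional Hausdorff measure at
least `(2R)^m`. -/
theorem ofReal_two_mul_pow_le_hausdorffMeasure {Y : Type*} [NormedAddCommGroup Y]
    [InnerProductSpace ℝ Y] [MeasurableSpace Y] [BorelSpace Y] {m : ℕ} (V : Submodule ℝ Y)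
    [FiniteDimensional ℝ V] (hV : Module.finrank ℝ V = m) {R : ℝ} (hR : 0 ≤ R) :
    ENNReal.ofReal (2 * R) ^ m ≤ μH[(m : ℝ)] ((V : Set Y) ∩ Metric.closedBall 0 R) := by
  subst hV
  set m := Module.finrank ℝ V
  let f : EuclideanSpace ℝ (Fin m) ≃ₗᵢ[ℝ] V := (stdOrthonormalBasis ℝ V).repr.symm
  have hf : Isometry (fun x => (f x : Y)) := V.subtypeₗᵢ.isometry.comp f.isometry
  have himg : (V : Set Y) ∩ Metric.closedBall 0 R = (fun x => (f x : Y)) '' Metric.closedBall 0 R := by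
    ext y
    constructor
    · rintro ⟨hy, hyR⟩
      refine ⟨f.symm ⟨y, hy⟩, ?_, by simp⟩
      simpa using hyR
    · rintro ⟨x, hx, rfl⟩
      refine ⟨(f x).2, ?_⟩
      rw [mem_closedBall_zero_iff] at hx ⊢
      exact (f.norm_map x).trans_le hx
  rw [himg, hf.hausdorffMeasure_image (Or.inl (by positivity)), addHaar_closedBall' _ _ hR,
    finrank_euclideanSpace_fin, ENNReal.ofReal_mul zero_le_two, mul_pow, ENNReal.ofReal_pow hR,
    mul_comm, ENNReal.ofReal_ofNat]
  gcongr
  exact two_pow_le_hausdorffMeasure_closedBall m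

/-- Used only in covering estimates, so any finite constant will do; it is uniform in `V` because
all these subspaces are isometric to one Euclidean space. -/
theorem hausdorffMeasure_inter_closedBall_le (Y : Type*) [NormedAddCommGroup Y]
    [InnerProductSpace ℝ Y] [MeasurableSpace Y] [BorelSpace Y] (m : ℕ) :
    ∃ C : ℝ, 0 < C ∧ ∀ V : Submodule ℝ Y, FiniteDimensional ℝ V → Module.finrank ℝ V = m →
      ∀ p ∈ V, ∀ R : ℝ, 0 ≤ R →
      μH[(m : ℝ)] ((V : Set Y) ∩ Metric.closedBall p R) ≤ ENNReal.ofReal (C * R ^ m) := by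
  refine ⟨(μH[(m : ℝ)] (Metric.closedBall (0 : EuclideanSpace ℝ (Fin m)) 1)).toReal,
    ENNReal.toReal_pos ?_ ?_, ?_⟩
  · exact (Metric.measure_closedBall_pos _ _ one_pos).ne'
  · exact measure_closedBall_lt_top.ne
  · intro V _ hV p hp R hR
    subst hV
    set m := Module.finrank ℝ V
    let f : EuclideanSpace ℝ (Fin m) ≃ₗᵢ[ℝ] V := (stdOrthonormalBasis ℝ V).repr.symm
    have hf : Isometry (fun x => (f x : Y)) := V.subtypeₗᵢ.isometry.comp f.isometry
    have himg : (V : Set Y) ∩ Metric.closedBall p R ⊆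
        (fun x => (f x : Y)) '' Metric.closedBall (f.symm ⟨p, hp⟩) R := by
      rintro y ⟨hy, hyR⟩
      refine ⟨f.symm ⟨y, hy⟩, ?_, by simp⟩
      rw [Metric.mem_closedBall, f.symm.dist_map]
      exact hyR
    refine (measure_mono himg).trans ?_
    rw [hf.hausdorffMeasure_image (Or.inl (by positivity)), addHaar_closedBall' _ _ hR,
      finrank_euclideanSpace_fin, mul_comm, ENNReal.ofReal_mul ENNReal.toReal_nonneg,
      ENNReal.ofReal_toReal measure_closedBall_lt_top.ne]

/-! ### Upper convex densities -/

/-- The set of points at which `μ` has arbitrarily small sets of large convex density. -/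
def convexDensityExceeds {X : Type*} [MetricSpace X] [MeasurableSpace X] (μ : Measure X) (m : ℕ)
    (δ : ℝ) : Set X :=
  {a | ∀ r > 0, ∃ U : Set X, ∃ D : ℝ, a ∈ U ∧ 0 < D ∧ D < r ∧ (∀ p ∈ U, ∀ q ∈ U, dist p q ≤ D) ∧
    (1 + δ) * D ^ m < μ.real U}

/-- A slight closed thickening keeps the strict mass inequality and gives the closed sets with
interior that the Vitali theorem needs. -/
theorem exists_closed_of_mem_convexDensityExceeds {X : Type*} [MetricSpace X] [MeasurableSpace X]
    {μ : Measure X} [IsFiniteMeasure μ] {m : ℕ} {δ : ℝ} {a : X}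
    (ha : a ∈ convexDensityExceeds μ m δ) {r : ℝ} (hr : 0 < r) :
    ∃ B : Set X, ∃ D : ℝ, IsClosed B ∧ a ∈ interior B ∧ 0 < D ∧ D < r ∧
      (∀ p ∈ B, ∀ q ∈ B, dist p q ≤ D) ∧ (1 + δ) * D ^ m < μ.real B := by
  obtain ⟨U, D, haU, hD, hDr, hU, hμ⟩ := ha r hr
  have ht : Tendsto (fun t : ℝ => (1 + δ) * (D + 2 * t) ^ m) (𝓝[>] 0) (𝓝 ((1 + δ) * D ^ m)) := by
    have : Continuous fun t : ℝ => (1 + δ) * (D + 2 * t) ^ m := by fun_prop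
    simpa using (this.tendsto 0).mono_left nhdsWithin_le_nhds
  have h2 : ∀ᶠ t : ℝ in 𝓝[>] 0, D + 2 * t < r := by
    have : Continuous fun t : ℝ => D + 2 * t := by fun_prop
    have h := (this.tendsto 0).mono_left (nhdsWithin_le_nhds (s := Set.Ioi 0))
    exact h.eventually_lt_const (by simpa using hDr)
  obtain ⟨t, ⟨h1, h2⟩, h3⟩ := ((ht.eventually_lt_const hμ).and h2 |>.and self_mem_nhdsWithin).exists
  have h3 : 0 < t := h3
  refine ⟨Metric.cthickening t U, D + 2 * t, Metric.isClosed_cthickening,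
    interior_mono (Metric.thickening_subset_cthickening t U)
      (by rw [Metric.isOpen_thickening.interior_eq]; exact Metric.self_subset_thickening h3 U haU),
    by linarith, h2, ?_, h1.trans_le (measureReal_mono (Metric.self_subset_cthickening U))⟩
  intro p hp q hq
  refine le_of_forall_pos_le_add fun ε hε => ?_
  have aux : ∀ z ∈ Metric.cthickening t U, ∃ z' ∈ U, dist z z' < t + ε / 2 := fun z hz =>
    Metric.mem_thickening_iff.1
      (Metric.cthickening_subset_thickening' (by linarith) (by linarith) U hz)
  obtain ⟨p', hp', hpp⟩ := aux p hp
  obtain ⟨q', hq', hqq⟩ := aux q hq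
  have := hU p' hp' q' hq'
  have := dist_triangle4 p p' q' q
  rw [dist_comm q' q] at this
  linarith

/-- At almost every point where the doubling condition holds, the upper convex density of the
restriction of the `m`-dimensional Hausdorff measure is at most one. -/
theorem measure_convexDensityExceeds_eq_zero {X : Type*} [MetricSpace X] [SecondCountableTopology X]
    [MeasurableSpace X] [BorelSpace X] {m : ℕ} {E : Set X}
    (hE : (μH[(m : ℝ)] : Measure X) E < ∞) {δ C : ℝ} (hδ : 0 < δ) {Z : Set X} (hZE : Z ⊆ E)
    (hZ : Z ⊆ convexDensityExceeds ((μH[(m : ℝ)] : Measure X).restrict E) m δ)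
    (hC : ∀ x ∈ Z, ∃ r₀ > 0, ∀ r : ℝ, 0 < r → r < r₀ →
      ((μH[(m : ℝ)] : Measure X).restrict E).real (Metric.closedBall x (3 * r)) ≤ C * r ^ m) :
    (μH[(m : ℝ)] : Measure X) Z = 0 := by
  set μ := (μH[(m : ℝ)] : Measure X).restrict E with hμ
  have : IsFiniteMeasure μ := ⟨by rwa [hμ, Measure.restrict_apply_univ]⟩
  have hHZ : ∀ S ⊆ Z, (μH[(m : ℝ)] : Measure X) S = μ S := fun S hS =>
    (Measure.restrict_eq_self _ (hS.trans hZE)).symm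
  have hone : 1 < ENNReal.ofReal (1 + δ) := by
    rw [← ENNReal.ofReal_one]; exact (ENNReal.ofReal_lt_ofReal_iff (by linarith)).2 (by linarith)
  -- fine covers by disjoint sets of large density inside an open set
  have key : ∀ O : Set X, IsOpen O → Z ⊆ O → ENNReal.ofReal (1 + δ) * μ Z ≤ μ O := by
    intro O hO hZO
    have cov : ∀ n : ℕ, ∃ u : Set (X × Set X × ℝ), u.Countable ∧
        (∀ a ∈ u, Metric.ediam a.2.1 ≤ ENNReal.ofReal (1 / (n + 1))) ∧
        μ (Z \ ⋃ a ∈ u, a.2.1) = 0 ∧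
        ENNReal.ofReal (1 + δ) * ∑' a : u, Metric.ediam a.1.2.1 ^ (m : ℝ) ≤ μ O := by
      intro n
      -- Triples of a centre, a closed set and a bound for its diameter. The last two clauses
      -- together give the doubling condition of the Vitali theorem.
      let t : Set (X × Set X × ℝ) := {a | IsClosed a.2.1 ∧ a.1 ∈ interior a.2.1 ∧ 0 < a.2.2 ∧
        a.2.2 < 1 / (n + 1) ∧ a.2.1 ⊆ O ∧ (∀ p ∈ a.2.1, ∀ q ∈ a.2.1, dist p q ≤ a.2.2) ∧
        (1 + δ) * a.2.2 ^ m < μ.real a.2.1 ∧ μ.real (Metric.closedBall a.1 (3 * a.2.2)) ≤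
          C * a.2.2 ^ m}
      obtain ⟨u, hut, huc, hud, hu0⟩ := Vitali.exists_disjoint_covering_ae μ Z t (Real.toNNReal C)
        (fun a => a.2.2) (fun a => a.1) (fun a => a.2.1)
        (fun a ha p hp => ha.2.2.2.2.2.1 p hp a.1 (interior_subset ha.2.1))
        (by
          intro a ha
          have h1 := ha.2.2.2.2.2.2.1
          have h2 := ha.2.2.2.2.2.2.2
          have hpos : 0 < a.2.2 ^ m := pow_pos ha.2.2.1 m
          have hC0 : 0 ≤ C := by
            by_contra hneg
            have := mul_neg_of_neg_of_pos (not_le.1 hneg) hpos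
            linarith [measureReal_nonneg (μ := μ) (s := Metric.closedBall a.1 (3 * a.2.2))]
          have h3 : μ.real (Metric.closedBall a.1 (3 * a.2.2)) ≤ C * μ.real a.2.1 :=
            h2.trans (mul_le_mul_of_nonneg_left (by nlinarith) hC0)
          rw [← ofReal_measureReal (μ := μ) (s := Metric.closedBall a.1 (3 * a.2.2)),
            ← ofReal_measureReal (μ := μ) (s := a.2.1)]
          change _ ≤ ENNReal.ofReal C * _
          rw [← ENNReal.ofReal_mul hC0]
          exact ENNReal.ofReal_le_ofReal h3)
        (fun a ha => ⟨a.1, ha.2.1⟩) (fun a ha => ha.1)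
        (by
          intro x hx ε hε
          obtain ⟨r₀, hr₀, hr⟩ := hC x hx
          obtain ⟨r₁, hr₁, hball⟩ := Metric.isOpen_iff.1 hO x (hZO hx)
          obtain ⟨B, D, hB, hxB, hD, hDr, hBD, hμB⟩ :=
            exists_closed_of_mem_convexDensityExceeds (hZ hx)
              (r := min (min ε r₀) (min r₁ (1 / (n + 1))))
              (lt_min (lt_min hε hr₀) (lt_min hr₁ (by positivity)))
          simp only [lt_min_iff] at hDr
          exact ⟨(x, B, D), ⟨hB, hxB, hD, hDr.2.2,
            fun p hp => hball ((hBD p hp x (interior_subset hxB)).trans_lt hDr.2.1), hBD, hμB,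
            hr D hD hDr.1.2⟩, hDr.1.1.le, rfl⟩)
      have hdiam : ∀ a ∈ t, Metric.ediam a.2.1 ≤ ENNReal.ofReal a.2.2 := fun a ha =>
        Metric.ediam_le fun p hp q hq => by
          rw [edist_dist]; exact ENNReal.ofReal_le_ofReal (ha.2.2.2.2.2.1 p hp q hq)
      refine ⟨u, huc, fun a ha => (hdiam a (hut ha)).trans
        (ENNReal.ofReal_le_ofReal (hut ha).2.2.2.1.le), hu0, ?_⟩
      rw [← ENNReal.tsum_mul_left]
      calc ∑' a : u, ENNReal.ofReal (1 + δ) * Metric.ediam a.1.2.1 ^ (m : ℝ)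
          ≤ ∑' a : u, μ a.1.2.1 := by
            refine ENNReal.tsum_le_tsum fun a => ?_
            have ha := hut a.2
            rw [ENNReal.rpow_natCast]
            calc ENNReal.ofReal (1 + δ) * Metric.ediam a.1.2.1 ^ m
                ≤ ENNReal.ofReal (1 + δ) * ENNReal.ofReal a.1.2.2 ^ m := by
                  gcongr; exact hdiam _ ha
              _ = ENNReal.ofReal ((1 + δ) * a.1.2.2 ^ m) := by
                  rw [ENNReal.ofReal_mul (by linarith), ENNReal.ofReal_pow ha.2.2.1.le]
              _ ≤ ENNReal.ofReal (μ.real a.1.2.1) :=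
                  ENNReal.ofReal_le_ofReal ha.2.2.2.2.2.2.1.le
              _ = μ a.1.2.1 := ofReal_measureReal
        _ = μ (⋃ a ∈ u, a.2.1) := by
            rw [measure_biUnion huc hud fun a ha => (hut ha).1.measurableSet]
        _ ≤ μ O := measure_mono (Set.iUnion₂_subset fun a ha => (hut ha).2.2.2.2.1)
    choose u huc hud hu0 hus using cov
    have hcount : ∀ n, Countable (u n) := fun n => (huc n).to_subtype
    -- Off the null set `N`, each of the families `u n` is a genuine cover, with diameters tending
    -- to zero, so their sums bound the Hausdorff measure.
    set N := ⋃ n, Z \ ⋃ a ∈ u n, a.2.1 with hN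
    have hN0 : μ N = 0 := measure_iUnion_null hu0
    have hle : (μH[(m : ℝ)] : Measure X) (Z \ N) ≤
        liminf (fun n => ∑' a : u n, Metric.ediam a.1.2.1 ^ (m : ℝ)) atTop := by
      refine hausdorffMeasure_le_liminf_tsum _ _ (fun n : ℕ => ENNReal.ofReal (1 / (n + 1))) ?_
        (fun n (a : u n) => a.1.2.1) (Eventually.of_forall fun n a => hud n a.1 a.2)
        (Eventually.of_forall fun n x hx => ?_)
      · rw [← ENNReal.ofReal_zero]
        exact ENNReal.tendsto_ofReal tendsto_one_div_add_atTop_nhds_zero_nat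
      · by_contra hcon
        refine hx.2 (Set.mem_iUnion.2 ⟨n, hx.1, fun h => hcon ?_⟩)
        obtain ⟨a, ha, hxa⟩ := Set.mem_iUnion₂.1 h
        exact Set.mem_iUnion.2 ⟨⟨a, ha⟩, hxa⟩
    have hZN : μ Z ≤ (μH[(m : ℝ)] : Measure X) (Z \ N) := by
      rw [hHZ _ Set.sdiff_subset, measure_sdiff_null hN0]
    calc ENNReal.ofReal (1 + δ) * μ Z
        ≤ ENNReal.ofReal (1 + δ) *
          liminf (fun n => ∑' a : u n, Metric.ediam a.1.2.1 ^ (m : ℝ)) atTop := by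
            gcongr; exact hZN.trans hle
      _ = liminf (fun n => ENNReal.ofReal (1 + δ) *
          ∑' a : u n, Metric.ediam a.1.2.1 ^ (m : ℝ)) atTop :=
            (ENNReal.liminf_const_mul_of_ne_top ENNReal.ofReal_ne_top).symm
      _ ≤ liminf (fun _ : ℕ => μ O) atTop := liminf_le_liminf (Eventually.of_forall hus)
      _ = μ O := liminf_const _
  rw [hHZ Z subset_rfl]
  have hfin : μ Z ≠ ∞ := measure_ne_top μ Z
  -- Outer regularity lets `O` shrink to `Z`; a factor above one then forces the finite number `μ Z`
  -- to vanish.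
  have h1 : ENNReal.ofReal (1 + δ) * μ Z ≤ μ Z := by
    refine le_of_forall_gt_imp_ge_of_dense fun c hc => ?_
    obtain ⟨O, hZO, hO, hOc⟩ := Z.exists_isOpen_lt_of_lt c hc
    exact (key O hO hZO).trans hOc.le
  by_contra h0
  have := (ENNReal.mul_lt_mul_iff_left (pos_iff_ne_zero.2 h0).ne' hfin).2 hone
  rw [one_mul] at this
  exact absurd h1 this.not_ge

/-! ### Closed sets that are symmetric about each of their points -/

section Reflection

open scoped Pointwise

variable {X : Type*} [NormedAddCommGroup X] [NormedSpace ℝ X]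

/-- The point reflections in `0` and then in `y` compose to the translation by `2y`. -/
theorem add_two_smul_mem_of_reflection {S : Set X} (h0 : (0 : X) ∈ S)
    (hrefl : ∀ y ∈ S, ∀ z ∈ S, (2 : ℝ) • y - z ∈ S) {y z : X} (hy : y ∈ S) (hz : z ∈ S) :
    z + (2 : ℝ) • y ∈ S := by
  have h1 := hrefl 0 h0 z hz
  rw [smul_zero, zero_sub] at h1
  have h2 := hrefl y hy _ h1
  rwa [sub_neg_eq_add, add_comm] at h2

theorem sum_two_mul_nat_smul_mem_of_reflection {S : Set X} (h0 : (0 : X) ∈ S)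
    (hrefl : ∀ y ∈ S, ∀ z ∈ S, (2 : ℝ) • y - z ∈ S) {ι : Type*} (s : Finset ι) (b : ι → X)
    (hb : ∀ i ∈ s, b i ∈ S) (n : ι → ℕ) : ∑ i ∈ s, (2 * (n i : ℝ)) • b i ∈ S := by
  classical
  have hk : ∀ y ∈ S, ∀ z ∈ S, ∀ k : ℕ, z + (2 * (k : ℝ)) • y ∈ S := by
    intro y hy z hz k
    induction k with
    | zero => simpa using hz
    | succ k ih =>
      convert add_two_smul_mem_of_reflection h0 hrefl hy ih using 1
      push_cast
      module
  induction s using Finset.induction_on with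
  | empty => simpa using h0
  | insert i s his ih =>
    rw [Finset.sum_insert his, add_comm]
    exact hk _ (hb i (Finset.mem_insert_self _ _)) _
      (ih fun j hj => hb j (Finset.mem_insert_of_mem hj)) _

/-- If `ρ`-separated subsets of `S ∩ closedBall 0 R` have at most `C (R / ρ)^m` points, then `S`
spans a space of dimension at most `m`. -/
theorem finrank_span_le_of_packing [FiniteDimensional ℝ X] {m : ℕ} {S : Set X} (h0 : (0 : X) ∈ S)
    (hrefl : ∀ y ∈ S, ∀ z ∈ S, (2 : ℝ) • y - z ∈ S) {C : ℝ}
    (hP : ∀ R ρ : ℝ, 0 < ρ → ρ ≤ R → ∀ T : Finset X, ↑T ⊆ S → (∀ t ∈ T, ‖t‖ ≤ R) →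
      (∀ s ∈ T, ∀ t ∈ T, s ≠ t → ρ ≤ ‖s - t‖) → T.card * ρ ^ m ≤ C * R ^ m) :
    Module.finrank ℝ (Submodule.span ℝ S) ≤ m := by
  classical
  obtain ⟨b, hbS, hspan, hli⟩ := exists_linearIndependent ℝ S
  have : Fintype b := hli.setFinite.fintype
  have hcard : Fintype.card b = Module.finrank ℝ (Submodule.span ℝ S) := by
    rw [← hspan, ← Set.toFinset_card, ← finrank_span_set_eq_card hli]
  let L : (b → ℝ) →ₗ[ℝ] X := Fintype.linearCombination ℝ (fun i : b => (i : X))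
  have hL : ∀ c : b → ℝ, L c = ∑ i, c i • (i : X) := fun c => Fintype.linearCombination_apply ..
  have hker : LinearMap.ker L = ⊥ :=
    LinearMap.ker_eq_bot.2 (hli.fintypeLinearCombination_injective)
  obtain ⟨K, hK, hanti⟩ := L.exists_antilipschitzWith hker
  have hKpos : (0 : ℝ) < K := hK
  -- Distinct vectors with even integer coordinates differ by at least `2` somewhere, and the
  -- antilipschitz constant `K` turns this into separation `2 / K`. Thus `S` contains `N ^ card b`
  -- separated points of norm at most `N * A`, which the packing bound excludes for large `N` unless
  -- `card b ≤ m`. The summand `ρ` in `A` below ensures `ρ ≤ N * A`.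
  set ρ : ℝ := 2 / K with hρ
  have hρpos : 0 < ρ := by positivity
  set A : ℝ := 2 * ∑ i : b, ‖(i : X)‖ + ρ with hA
  have hApos : 0 < A := by positivity
  have main : ∀ N : ℕ, 1 ≤ N → (N : ℝ) ^ Fintype.card b * ρ ^ m ≤ C * (N * A) ^ m := by
    intro N hN
    let p : (b → Fin N) → X := fun n => ∑ i : b, (2 * ((n i : ℕ) : ℝ)) • (i : X)
    have hsep : ∀ n n', n ≠ n' → ρ ≤ ‖p n - p n'‖ := by
      intro n n' hne
      obtain ⟨i, hi⟩ := Function.ne_iff.1 hne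
      have h1 := hanti.le_mul_dist (fun i => 2 * ((n i : ℕ) : ℝ)) (fun i => 2 * ((n' i : ℕ) : ℝ))
      rw [hL, hL, dist_eq_norm, dist_eq_norm] at h1
      have h2 := norm_le_pi_norm
        ((fun i => 2 * ((n i : ℕ) : ℝ)) - fun i => 2 * ((n' i : ℕ) : ℝ) : b → ℝ) i
      have h3 : (2 : ℝ) ≤ ‖2 * ((n i : ℕ) : ℝ) - 2 * ((n' i : ℕ) : ℝ)‖ := by
        have h4 : (1 : ℤ) ≤ |((n i : ℕ) : ℤ) - ((n' i : ℕ) : ℤ)| := by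
          refine Int.one_le_abs (sub_ne_zero.2 fun h => hi (Fin.ext ?_))
          exact_mod_cast h
        have h5 : (1 : ℝ) ≤ |((n i : ℕ) : ℝ) - ((n' i : ℕ) : ℝ)| := by exact_mod_cast h4
        rw [← mul_sub, Real.norm_eq_abs, abs_mul, abs_two]
        linarith
      rw [hρ, div_le_iff₀ hKpos, mul_comm]
      exact h3.trans (h2.trans h1)
    have hinj : Function.Injective p := by
      intro n n' h
      by_contra hne
      have := hsep n n' hne
      rw [h, sub_self, norm_zero] at this
      linarith
    have hNr : (1 : ℝ) ≤ N := by exact_mod_cast hN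
    have h := hP (N * A) ρ hρpos ?_ (Finset.univ.image p) ?_ ?_ ?_
    · rw [Finset.card_image_of_injective _ hinj] at h
      simpa using h
    · have hs : 0 ≤ ∑ i : b, ‖(i : X)‖ := by positivity
      nlinarith
    · intro x hx
      obtain ⟨n, -, rfl⟩ := Finset.mem_image.1 hx
      exact sum_two_mul_nat_smul_mem_of_reflection h0 hrefl _ _ (fun i _ => hbS i.2) fun i => (n i : ℕ)
    · intro x hx
      obtain ⟨n, -, rfl⟩ := Finset.mem_image.1 hx
      calc ‖p n‖ ≤ ∑ i : b, ‖(2 * ((n i : ℕ) : ℝ)) • (i : X)‖ := norm_sum_le _ _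
        _ ≤ ∑ i : b, 2 * N * ‖(i : X)‖ := by
            refine Finset.sum_le_sum fun i _ => ?_
            rw [norm_smul, Real.norm_of_nonneg (by positivity)]
            have : ((n i : ℕ) : ℝ) ≤ N := by exact_mod_cast (n i).2.le
            gcongr
        _ = N * (2 * ∑ i : b, ‖(i : X)‖) := by rw [← Finset.mul_sum]; ring
        _ ≤ N * A := by gcongr; linarith
    · intro x hx y hy hxy
      obtain ⟨n, -, rfl⟩ := Finset.mem_image.1 hx
      obtain ⟨n', -, rfl⟩ := Finset.mem_image.1 hy
      exact hsep n n' fun h => hxy (h ▸ rfl)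
  rw [← hcard]
  by_contra! hlt
  obtain ⟨N, hN⟩ := exists_nat_gt (max 1 (C * A ^ m / ρ ^ m))
  rw [max_lt_iff] at hN
  have hN1 : 1 ≤ N := by exact_mod_cast hN.1.le
  have h1 := main N hN1
  have hNpos : (0 : ℝ) < (N : ℝ) ^ m := by have := hN.1; positivity
  have h2 : (N : ℝ) ^ (m + 1) ≤ (N : ℝ) ^ Fintype.card b :=
    pow_le_pow_right₀ hN.1.le hlt
  have h3 : (N : ℝ) ^ m * (N * ρ ^ m) ≤ (N : ℝ) ^ m * (C * A ^ m) := by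
    calc (N : ℝ) ^ m * (N * ρ ^ m) = (N : ℝ) ^ (m + 1) * ρ ^ m := by ring
      _ ≤ (N : ℝ) ^ Fintype.card b * ρ ^ m := by gcongr
      _ ≤ C * (N * A) ^ m := h1
      _ = (N : ℝ) ^ m * (C * A ^ m) := by rw [mul_pow]; ring
  have h4 := le_of_mul_le_mul_left h3 hNpos
  have h5 := (div_lt_iff₀ (by positivity)).1 hN.2
  linarith

/-- A lower bound for the `w`-dimensional Haar measure of a compact set that cannot be covered
efficiently by balls, when `w ≤ m`. -/
theorem le_of_forall_finite_cover {W : Type*} [NormedAddCommGroup W] [NormedSpace ℝ W]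
    [FiniteDimensional ℝ W] [MeasurableSpace W] [BorelSpace W] (lam : Measure W)
    [lam.IsAddHaarMeasure] {m : ℕ} (hw : Module.finrank ℝ W ≤ m) {Z : Set W} (hZ : IsCompact Z)
    {c : ℝ} (hQ : ∀ (T : Finset W) (ρ : W → ℝ), (∀ t ∈ T, 0 < ρ t) →
      Z ⊆ ⋃ t ∈ T, Metric.ball t (ρ t) → c ≤ ∑ t ∈ T, ρ t ^ m) {δ : ℝ} (hδ : 0 < δ) :
    c * lam.real (Metric.ball 0 1) ≤
      2 ^ m * δ ^ (m - Module.finrank ℝ W) * (lam.real Z + δ) := by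
  classical
  set κ := lam.real (Metric.ball (0 : W) 1) with hκ
  obtain ⟨t, r, htc, htZ, htr, hcov, hsum⟩ := Besicovitch.exists_closedBall_covering_tsum_measure_le
    lam (ε := ENNReal.ofReal δ) (by simpa using hδ) (fun _ => Set.Ioo 0 δ) Z
    (fun x _ δ' hδ' => ⟨min δ δ' / 2, by
      have := lt_min hδ hδ'
      have h1 := min_le_left δ δ'
      have h2 := min_le_right δ δ'
      constructor <;> constructor <;> linarith⟩)
  -- Doubling the radii makes the cover open, so that compactness applies; this costs the factor `2
  -- ^ m`.
  obtain ⟨t', ht', hfin, hcov'⟩ := hZ.elim_finite_subcover_image (b := t)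
    (c := fun x => Metric.ball x (2 * r x)) (fun x _ => Metric.isOpen_ball)
    (hcov.trans (Set.iUnion₂_mono fun x hx => Metric.closedBall_subset_ball (by
      have := (htr x hx).1; linarith)))
  have hmem : ∀ x ∈ hfin.toFinset, x ∈ t := fun x hx => ht' (hfin.mem_toFinset.1 hx)
  have h1 := hQ hfin.toFinset (fun x => 2 * r x)
    (fun x hx => by have := (htr x (hmem x hx)).1; linarith) (by simpa using hcov')
  have h2 : ∑ x ∈ hfin.toFinset, r x ^ Module.finrank ℝ W * κ ≤ lam.real Z + δ := by
    have h3 : ∑ x ∈ hfin.toFinset, lam (Metric.closedBall x (r x)) ≤ lam Z + ENNReal.ofReal δ := by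
      refine le_trans ?_ hsum
      calc ∑ x ∈ hfin.toFinset, lam (Metric.closedBall x (r x))
          = ∑' x : (hfin.toFinset : Set W), lam (Metric.closedBall x (r x)) := by
            rw [← Finset.tsum_subtype]; rfl
        _ ≤ _ := ENNReal.tsum_mono_subtype (fun x => lam (Metric.closedBall x (r x)))
            (fun x hx => hmem x hx)
    have h4 := ENNReal.toReal_mono (by simp [hZ.measure_lt_top.ne]) h3
    rw [ENNReal.toReal_sum (fun x _ => measure_closedBall_lt_top.ne),
      ENNReal.toReal_add hZ.measure_lt_top.ne ENNReal.ofReal_ne_top,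
      ENNReal.toReal_ofReal hδ.le] at h4
    refine le_trans (le_of_eq (Finset.sum_congr rfl fun x hx => ?_)) h4
    exact (addHaar_real_closedBall lam x (htr x (hmem x hx)).1.le).symm
  have hκ0 : 0 ≤ κ := measureReal_nonneg
  calc c * κ ≤ (∑ x ∈ hfin.toFinset, (2 * r x) ^ m) * κ := by gcongr
    _ ≤ (∑ x ∈ hfin.toFinset, 2 ^ m * δ ^ (m - Module.finrank ℝ W) *
        r x ^ Module.finrank ℝ W) * κ := by
      gcongr with x hx
      obtain ⟨hr0, hrδ⟩ := htr x (hmem x hx)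
      -- All radii are below `δ`, so the surplus `m - finrank` powers of the radius are at most
      -- powers of `δ`.
      have : r x ^ m = r x ^ (m - Module.finrank ℝ W) * r x ^ Module.finrank ℝ W := by
        rw [← pow_add, Nat.sub_add_cancel hw]
      rw [mul_pow, this, ← mul_assoc]
      gcongr
    _ = 2 ^ m * δ ^ (m - Module.finrank ℝ W) *
        ∑ x ∈ hfin.toFinset, r x ^ Module.finrank ℝ W * κ := by
      rw [← Finset.mul_sum, ← Finset.sum_mul]; ring
    _ ≤ _ := by gcongr

/-- A closed set that is symmetric about each of its points and has exactly `m`-dimensional packing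
and covering numbers is an `m`-dimensional linear subspace. -/
theorem exists_submodule_eq_of_reflection [FiniteDimensional ℝ X] {m : ℕ} {S : Set X}
    (hS : IsClosed S) (h0 : (0 : X) ∈ S)
    (hrefl : ∀ y ∈ S, ∀ z ∈ S, (2 : ℝ) • y - z ∈ S) {C c : ℝ} (hc : 0 < c)
    (hP : ∀ R ρ : ℝ, 0 < ρ → ρ ≤ R → ∀ T : Finset X, ↑T ⊆ S → (∀ t ∈ T, ‖t‖ ≤ R) →
      (∀ s ∈ T, ∀ t ∈ T, s ≠ t → ρ ≤ ‖s - t‖) → T.card * ρ ^ m ≤ C * R ^ m)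
    (hQ : ∀ (T : Finset X) (ρ : X → ℝ), (∀ t ∈ T, 0 < ρ t) →
      S ∩ Metric.closedBall 0 1 ⊆ ⋃ t ∈ T, Metric.ball t (ρ t) → c ≤ ∑ t ∈ T, ρ t ^ m) :
    ∃ W : Submodule ℝ X, Module.finrank ℝ W = m ∧ S = W := by
  classical
  set W := Submodule.span ℝ S with hW
  let _ : MeasurableSpace W := borel W
  have : BorelSpace W := ⟨rfl⟩
  have hw : Module.finrank ℝ W ≤ m := finrank_span_le_of_packing h0 hrefl hP
  let lam : Measure W := addHaar
  set S' : Set W := {z | (z : X) ∈ S} with hS'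
  have hS'c : IsClosed S' := hS.preimage continuous_subtype_val
  set Z : Set W := S' ∩ Metric.closedBall 0 1 with hZ
  have hZc : IsCompact Z := (isCompact_closedBall 0 1).inter_left hS'c
  have hQ' : ∀ (T : Finset W) (ρ : W → ℝ), (∀ t ∈ T, 0 < ρ t) →
      Z ⊆ ⋃ t ∈ T, Metric.ball t (ρ t) → c ≤ ∑ t ∈ T, ρ t ^ m := by
    intro T ρ hρ hcov
    let ρ' : X → ℝ := fun x => if hx : x ∈ W then ρ ⟨x, hx⟩ else 0
    have hρ' : ∀ t : W, ρ' t = ρ t := fun t => by simp [ρ']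
    have h := hQ (T.map ⟨Subtype.val, Subtype.val_injective⟩) ρ' ?_ ?_
    · simpa [hρ'] using h
    · intro t ht
      obtain ⟨t, ht', rfl⟩ := Finset.mem_map.1 ht
      simpa [hρ'] using hρ t ht'
    · rintro x ⟨hxS, hx1⟩
      have hxW : x ∈ W := Submodule.subset_span hxS
      have hxZ : (⟨x, hxW⟩ : W) ∈ Z := ⟨hxS, by simpa using hx1⟩
      obtain ⟨t, ht, hxt⟩ := Set.mem_iUnion₂.1 (hcov hxZ)
      refine Set.mem_iUnion₂.2 ⟨t, Finset.mem_map.2 ⟨t, ht, rfl⟩, ?_⟩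
      rw [hρ']
      exact hxt
  have hκ : 0 < lam.real (Metric.ball (0 : W) 1) :=
    ENNReal.toReal_pos (Metric.measure_ball_pos _ _ one_pos).ne' measure_ball_lt_top.ne
  have main := fun δ hδ => le_of_forall_finite_cover lam hw hZc hQ' (δ := δ) hδ
  set κ := lam.real (Metric.ball (0 : W) 1)
  -- Let `δ → 0`. If the span had dimension below `m`, the right side would vanish; in dimension `m`
  -- the limit forces `Z` to have positive Haar measure.
  have hlim : ∀ n : ℕ, ∀ a : ℝ, (∀ δ : ℝ, 0 < δ → c * κ ≤ 2 ^ m * δ ^ n * (a + δ)) →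
      c * κ ≤ 2 ^ m * 0 ^ n * (a + 0) := by
    intro n a h
    have hcont : Continuous fun δ : ℝ => 2 ^ m * δ ^ n * (a + δ) := by fun_prop
    exact ge_of_tendsto ((hcont.tendsto 0).mono_left (nhdsWithin_le_nhds (s := Set.Ioi 0)))
      (by filter_upwards [self_mem_nhdsWithin] with δ hδ using h δ hδ)
  have hfin := hlim _ _ main
  have hcκ : 0 < c * κ := by positivity
  have hwm : Module.finrank ℝ W = m := by
    by_contra hne
    rw [zero_pow (by omega)] at hfin
    linarith
  have hZpos : lam Z ≠ 0 := by
    intro h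
    rw [measureReal_def, h] at hfin
    simp at hfin
    linarith
  -- Steinhaus: every `v` near a point `z` of `S'` is `z - 2b + 2a` with `a`, `b` in `Z`. Since `S`
  -- is invariant under translation by `2S`, such `v` lie in it, so `S'` is open as well as closed.
  have hnhds : Z - Z ∈ 𝓝 (0 : W) :=
    sub_mem_nhds_zero_of_addHaar_pos_ne_top lam Z hZc.measurableSet (pos_iff_ne_zero.2 hZpos)
      hZc.measure_lt_top.ne
  have hopen : IsOpen S' := by
    rw [isOpen_iff_mem_nhds]
    intro z hz
    have hcont : Continuous fun v : W => (1 / 2 : ℝ) • (v - z) := by fun_prop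
    have hpre := hcont.continuousAt.preimage_mem_nhds (x := z) (t := Z - Z) (by simpa using hnhds)
    filter_upwards [hpre] with v hv
    obtain ⟨a, ha, b, hb, hab⟩ := Set.mem_sub.1 hv
    have h1 : (v : X) = (z : X) + (2 : ℝ) • (-(b : X)) + (2 : ℝ) • (a : X) := by
      have h2 : v = z + (2 : ℝ) • (a - b) := by rw [hab]; module
      rw [h2]
      push_cast
      module
    have hb' : -(b : X) ∈ S := by simpa using hrefl 0 h0 b hb.1
    rw [hS', Set.mem_ofPred_eq, h1]
    exact add_two_smul_mem_of_reflection h0 hrefl ha.1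
      (add_two_smul_mem_of_reflection h0 hrefl hb' hz)
  have huniv : S' = Set.univ := IsClopen.eq_univ ⟨hS'c, hopen⟩ ⟨0, by simpa [hS'] using h0⟩
  refine ⟨W, hwm, Set.Subset.antisymm Submodule.subset_span fun x hx => ?_⟩
  have : (⟨x, hx⟩ : W) ∈ S' := huniv ▸ Set.mem_univ _
  exact this

end Reflection

/-! ### Limits of sequences of sets with asymptotically uniform measures -/

section Limits

variable {X : Type*} [NormedAddCommGroup X]

/-- The limit along `l` of a sequence of sets. -/
def limitSet (l : Filter ℕ) (F : ℕ → Set X) : Set X :=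
  {y | ∀ ε > 0, ∀ᶠ k in l, ∃ z ∈ F k, ‖z - y‖ < ε}

theorem isClosed_limitSet (l : Filter ℕ) (F : ℕ → Set X) : IsClosed (limitSet l F) := by
  refine isClosed_of_closure_subset fun y hy ε hε => ?_
  obtain ⟨y', hy', hyy⟩ := Metric.mem_closure_iff.1 hy (ε / 2) (by positivity)
  filter_upwards [hy' (ε / 2) (by positivity)] with k hk
  obtain ⟨z, hz, hzy⟩ := hk
  refine ⟨z, hz, ?_⟩
  rw [← dist_eq_norm] at hzy ⊢
  have := dist_triangle z y' y
  rw [dist_comm] at hyy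
  linarith

/-- Along an ultrafilter a bounded selection converges without passing to a subsequence. -/
theorem exists_mem_limitSet_of_bounded [ProperSpace X] {l : Ultrafilter ℕ} {F : ℕ → Set X}
    {z : ℕ → X} {R : ℝ} (hz : ∀ᶠ k in (l : Filter ℕ), z k ∈ F k ∧ ‖z k‖ ≤ R) :
    ∃ y ∈ limitSet l F, ‖y‖ ≤ R ∧ Tendsto z l (𝓝 y) := by
  have hle : ((l.map z : Ultrafilter X) : Filter X) ≤ 𝓟 (Metric.closedBall 0 R) := by
    rw [le_principal_iff]
    change ∀ᶠ k in (l : Filter ℕ), z k ∈ Metric.closedBall 0 R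
    filter_upwards [hz] with k hk using by simpa using hk.2
  obtain ⟨y, hy, hly⟩ := (isCompact_closedBall (0 : X) R).ultrafilter_le_nhds _ hle
  have ht : Tendsto z l (𝓝 y) := hly
  refine ⟨y, fun ε hε => ?_, by simpa using hy, ht⟩
  filter_upwards [hz, Metric.tendsto_nhds.1 ht ε hε] with k hk hk'
  exact ⟨z k, hk.1, by rwa [← dist_eq_norm]⟩

/-- A sequence of measures `ν k` and sets `F k ∋ 0` such that, asymptotically along `l`, the measure
is carried by `F k` on every ball, has `m`-density one on balls centred on `F k` and
convex density at most one on sets that meet `F k`. -/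
structure IsAsymptoticallyUniform [MeasurableSpace X] (l : Filter ℕ) (m : ℕ) (ν : ℕ → Measure X)
    (F : ℕ → Set X) : Prop where
  finite : ∀ k, IsFiniteMeasure (ν k)
  measurableSet : ∀ k, MeasurableSet (F k)
  zero_mem : ∀ k, (0 : X) ∈ F k
  lower : ∀ δ > 0, ∀ R : ℝ, ∀ᶠ k in l, ∀ z ∈ F k, ∀ ρ : ℝ, 0 < ρ → ρ ≤ R →
    (1 - δ) * (2 * ρ) ^ m ≤ (ν k).real (Metric.ball z ρ)
  upper : ∀ δ > 0, ∀ R : ℝ, ∀ᶠ k in l, ∀ U : Set X, MeasurableSet U → ∀ z ∈ U, z ∈ F k →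
    ∀ D : ℝ, 0 < D → D ≤ R → (∀ p ∈ U, ∀ q ∈ U, ‖p - q‖ ≤ D) → (ν k).real U ≤ (1 + δ) * D ^ m
  compl : ∀ δ > 0, ∀ R > 0, ∀ᶠ k in l, (ν k).real (Metric.ball 0 R \ F k) ≤ δ

variable [MeasurableSpace X] {m : ℕ} {ν : ℕ → Measure X} {F : ℕ → Set X}

theorem IsAsymptoticallyUniform.zero_mem_limitSet {l : Filter ℕ}
    (h : IsAsymptoticallyUniform l m ν F) : (0 : X) ∈ limitSet l F := fun ε hε =>
  Eventually.of_forall fun k => ⟨0, h.zero_mem k, by simpa using hε⟩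

variable [BorelSpace X]

/-- Take disjoint balls, of radius `ρ - 2τ` near `y` and `τ` near `z`. Their total mass exceeds what
convex density allows for diameter `D = 2(ρ - 2τ)`, yet each ball alone has diameter at most `D`;
the excess must come from a pair with one point in each. -/
theorem IsAsymptoticallyUniform.exists_far_pair {l : Filter ℕ}
    (h : IsAsymptoticallyUniform l m ν F) {y z : X} (hy : y ∈ limitSet l F) (hz : z ∈ limitSet l F)
    {τ : ℝ} (hτ : 0 < τ) (hτ' : 4 * τ < ‖y - z‖) :
    ∀ᶠ k in l, ∃ p ∈ F k, ∃ q ∈ F k, ‖p - z‖ ≤ 2 * τ ∧ ‖q - y‖ ≤ ‖y - z‖ ∧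
      2 * (‖y - z‖ - 2 * τ) ≤ ‖p - q‖ := by
  set ρ := ‖y - z‖ with hρ
  set D := 2 * (ρ - 2 * τ) with hD
  have hDpos : 0 < D := by linarith
  -- If no far pair exists, the mass bounds give `(2τ) ^ m ≤ δ (2 D ^ m + (2τ) ^ m + 1)`. This
  -- choice makes the right side half of the left.
  set δ := (2 * τ) ^ m / (2 * (2 * D ^ m + (2 * τ) ^ m + 1)) with hδdef
  have hδ : 0 < δ := by positivity
  set R := ‖y‖ + ‖z‖ + 2 * ρ + D with hR
  have hRpos : 0 < R := by positivity
  filter_upwards [h.lower δ hδ R, h.upper δ hδ R, h.compl δ hδ R hRpos,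
    hy (τ / 2) (by positivity), hz (τ / 2) (by positivity)] with k hlow hup hcom hyk hzk
  obtain ⟨y', hy'F, hy'⟩ := hyk
  obtain ⟨z', hz'F, hz'⟩ := hzk
  have := h.finite k
  by_contra! hcon
  have hmF := h.measurableSet k
  set A := Metric.ball y' (ρ - 2 * τ) with hA
  set B := Metric.ball z' τ with hB
  have hyz' : ρ - τ ≤ ‖y' - z'‖ := by
    have e : y - z = (y' - z') - (y' - y) + (z' - z) := by abel
    have h1 : ρ ≤ ‖y' - z'‖ + ‖y' - y‖ + ‖z' - z‖ := by
      rw [hρ, e]; exact (norm_add_le _ _).trans (by gcongr; exact norm_sub_le _ _)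
    linarith
  have hdisj : Disjoint A B := Metric.ball_disjoint_ball (by rw [dist_eq_norm]; linarith)
  have hAB : A ∪ B ⊆ Metric.ball 0 R := by
    have h1 := norm_sub_norm_le y' y
    have h2 := norm_sub_norm_le z' z
    have h3 := norm_nonneg y
    have h4 := norm_nonneg z
    refine Set.union_subset (Metric.ball_subset_ball' ?_) (Metric.ball_subset_ball' ?_) <;>
      rw [dist_zero_right] <;> linarith
  have hmass : (ν k).real (A ∪ B) ≤ (ν k).real (F k ∩ (A ∪ B)) + δ := by
    have h1 : A ∪ B ⊆ F k ∩ (A ∪ B) ∪ (Metric.ball 0 R \ F k) := fun x hx => by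
      by_cases hxF : x ∈ F k
      · exact Or.inl ⟨hxF, hx⟩
      · exact Or.inr ⟨hAB hx, hxF⟩
    exact (measureReal_mono h1).trans ((measureReal_union_le _ _).trans (by gcongr))
  rw [measureReal_union hdisj Metric.isOpen_ball.measurableSet] at hmass
  have hlowA := hlow y' hy'F (ρ - 2 * τ) (by linarith) (by
    have h3 := norm_nonneg y
    have h4 := norm_nonneg z
    linarith)
  have hlowB := hlow z' hz'F τ hτ (by
    have h3 := norm_nonneg y
    have h4 := norm_nonneg z
    linarith)
  have hupU := hup (F k ∩ (A ∪ B))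
    (hmF.inter (Metric.isOpen_ball.measurableSet.union Metric.isOpen_ball.measurableSet)) y'
    ⟨hy'F, Or.inl (Metric.mem_ball_self (by linarith))⟩ hy'F D hDpos (by
      have h3 := norm_nonneg y
      have h4 := norm_nonneg z
      linarith) (by
      have hcross : ∀ p ∈ F k, ∀ q ∈ F k, p ∈ B → q ∈ A → ‖p - q‖ ≤ D := by
        intro p hp q hq hpB hqA
        rw [hB, mem_ball_iff_norm] at hpB
        rw [hA, mem_ball_iff_norm] at hqA
        refine (hcon p hp q hq ?_ ?_).le
        · have := norm_sub_le_norm_sub_add_norm_sub p z' z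
          linarith
        · have := norm_sub_le_norm_sub_add_norm_sub q y' y
          linarith
      rintro p ⟨hpF, hp⟩ q ⟨hqF, hq⟩
      rcases hp with hp | hp <;> rcases hq with hq | hq
      · rw [hA, mem_ball_iff_norm] at hp hq
        have := norm_sub_le_norm_sub_add_norm_sub p y' q
        rw [norm_sub_rev y' q] at this
        linarith
      · rw [norm_sub_rev]; exact hcross q hqF p hpF hq hp
      · exact hcross p hpF q hqF hp hq
      · rw [hB, mem_ball_iff_norm] at hp hq
        have := norm_sub_le_norm_sub_add_norm_sub p z' q
        rw [norm_sub_rev z' q] at this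
        linarith)
  rw [← hD] at hlowA
  have h1 : (2 * τ) ^ m ≤ δ * (2 * D ^ m + (2 * τ) ^ m + 1) := by nlinarith
  have h2 : δ * (2 * D ^ m + (2 * τ) ^ m + 1) = (2 * τ) ^ m / 2 := by
    rw [hδdef]; field_simp
  have h3 : 0 < (2 * τ) ^ m := by positivity
  linarith

/-- The far pairs give, as `τ → 0`, a limit point `q` with `‖q - y‖ ≤ ρ` and `‖q - z‖ ≥ 2ρ`.
Equality then holds in the triangle inequality, so strict convexity gives `q - y = y - z`. -/
theorem IsAsymptoticallyUniform.reflection_mem [NormedSpace ℝ X] [ProperSpace X]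
    [StrictConvexSpace ℝ X] {l : Ultrafilter ℕ}
    (h : IsAsymptoticallyUniform l m ν F) {y z : X} (hy : y ∈ limitSet l F)
    (hz : z ∈ limitSet l F) : (2 : ℝ) • y - z ∈ limitSet l F := by
  rcases eq_or_ne y z with rfl | hne
  · convert hy using 1; module
  have hρ : 0 < ‖y - z‖ := norm_pos_iff.2 (sub_ne_zero.2 hne)
  set ρ := ‖y - z‖ with hρdef
  have step : ∀ τ : ℝ, 0 < τ → 4 * τ < ρ →
      ∃ q ∈ limitSet l F, ‖q - y‖ ≤ ρ ∧ 2 * ρ - 6 * τ ≤ ‖q - z‖ := by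
    intro τ hτ hτ'
    have hev := h.exists_far_pair hy hz hτ hτ'
    rw [← hρdef] at hev
    choose! p hp q hq hpz hqy hpq using fun k (hk : ∃ p ∈ F k, ∃ q ∈ F k, ‖p - z‖ ≤ 2 * τ ∧
      ‖q - y‖ ≤ ρ ∧ 2 * (ρ - 2 * τ) ≤ ‖p - q‖) => hk
    obtain ⟨q', hq', -, hqt⟩ := exists_mem_limitSet_of_bounded (F := F) (z := q) (R := ‖y‖ + ρ) (by
      filter_upwards [hev] with k hk
      refine ⟨hq k hk, ?_⟩
      have := norm_le_norm_add_norm_sub y (q k)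
      have := hqy k hk
      rw [norm_sub_rev] at this
      linarith)
    refine ⟨q', hq', le_of_tendsto ((hqt.sub_const y).norm) ?_, ge_of_tendsto ((hqt.sub_const z).norm) ?_⟩
    · filter_upwards [hev] with k hk using hqy k hk
    · filter_upwards [hev] with k hk
      have h1 := hpz k hk
      have h2 := hpq k hk
      have h3 := norm_sub_le_norm_sub_add_norm_sub (p k) z (q k)
      rw [norm_sub_rev z] at h3
      linarith
  have hK : IsCompact (limitSet l F ∩ Metric.closedBall y ρ) :=
    (isCompact_closedBall y ρ).inter_left (isClosed_limitSet _ _)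
  -- One maximizer of the distance to `z` serves all `τ` at once.
  obtain ⟨q, ⟨hq, hqy⟩, hmax⟩ := hK.exists_isMaxOn ⟨y, hy, Metric.mem_closedBall_self hρ.le⟩
    (f := fun q => ‖q - z‖) (by fun_prop)
  rw [mem_closedBall_iff_norm] at hqy
  have hqz : 2 * ρ ≤ ‖q - z‖ := by
    refine le_of_forall_pos_le_add fun ε hε => ?_
    have hm := lt_min hε hρ
    obtain ⟨q', hq', hq'y, hq'z⟩ := step (min ε ρ / 8) (by linarith)
      (by have := min_le_right ε ρ; linarith)
    have : ‖q' - z‖ ≤ ‖q - z‖ := hmax ⟨hq', mem_closedBall_iff_norm.2 hq'y⟩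
    have := min_le_left ε ρ
    linarith
  have e : q - z = (q - y) + (y - z) := by abel
  have htri : ‖q - z‖ ≤ ‖q - y‖ + ‖y - z‖ := by rw [e]; exact norm_add_le _ _
  have hray : SameRay ℝ (q - y) (y - z) := by
    rw [sameRay_iff_norm_add, ← e]
    linarith
  have heq : q - y = y - z := by
    rw [← hray.norm_eq_iff]
    linarith
  have : (2 : ℝ) • y - z = q := by
    rw [sub_eq_iff_eq_add.1 heq]; module
  rwa [this]

/-- Move each point into `F k`. The balls of radius `ρ / 4` about the new points are disjoint, have
mass comparable to `ρ ^ m`, and lie in a ball of mass at most a constant times `R ^ m`. -/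
theorem IsAsymptoticallyUniform.packing {l : Filter ℕ} [l.NeBot]
    (h : IsAsymptoticallyUniform l m ν F) (R ρ : ℝ) (hρ : 0 < ρ) (hρR : ρ ≤ R) (T : Finset X)
    (hT : ↑T ⊆ limitSet l F) (hTR : ∀ t ∈ T, ‖t‖ ≤ R)
    (hsep : ∀ s ∈ T, ∀ t ∈ T, s ≠ t → ρ ≤ ‖s - t‖) : T.card * ρ ^ m ≤ 3 * 8 ^ m * R ^ m := by
  have hev : ∀ᶠ k in l, ∀ t ∈ T, ∃ z ∈ F k, ‖z - t‖ < ρ / 8 :=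
    (eventually_all_finset T).2 fun t ht => hT ht (ρ / 8) (by positivity)
  have hR : 0 < R := hρ.trans_le hρR
  obtain ⟨k, ⟨hlow, hup⟩, hk⟩ := ((h.lower (1 / 2) (by norm_num) R).and
    (h.upper (1 / 2) (by norm_num) (4 * R)) |>.and hev).exists
  have := h.finite k
  choose! g hgF hg using hk
  have hdisj : (T : Set X).PairwiseDisjoint fun t => Metric.ball (g t) (ρ / 4) := by
    intro s hs t ht hst
    refine Metric.ball_disjoint_ball ?_
    have h1 := hsep s hs t ht hst
    have h2 := hg s hs
    have h3 := hg t ht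
    rw [← dist_eq_norm] at h1 h2 h3
    have := dist_triangle4 s (g s) (g t) t
    rw [dist_comm s (g s)] at this
    linarith
  have hsub : (⋃ t ∈ T, Metric.ball (g t) (ρ / 4)) ⊆ Metric.ball 0 (2 * R) := by
    refine Set.iUnion₂_subset fun t ht => Metric.ball_subset_ball' ?_
    have h1 := hTR t ht
    have h2 := hg t ht
    have := norm_sub_norm_le (g t) t
    rw [dist_zero_right]
    linarith
  have h1 := measureReal_mono (μ := ν k) hsub
  rw [measureReal_biUnion_finset hdisj fun t _ => Metric.isOpen_ball.measurableSet] at h1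
  have h2 : (T.card : ℝ) * ((1 - 1 / 2) * (2 * (ρ / 4)) ^ m) ≤
      ∑ t ∈ T, (ν k).real (Metric.ball (g t) (ρ / 4)) := by
    rw [← nsmul_eq_mul]
    exact Finset.card_nsmul_le_sum _ _ _ fun t ht =>
      hlow _ (hgF t ht) _ (by positivity) (by linarith)
  have h3 := hup (Metric.ball 0 (2 * R)) Metric.isOpen_ball.measurableSet 0
    (Metric.mem_ball_self (by positivity)) (h.zero_mem k) (4 * R) (by positivity) le_rfl
    (fun p hp q hq => by
      rw [mem_ball_zero_iff] at hp hq
      linarith [norm_sub_le p q])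
  have h4 : (T.card : ℝ) * ((1 - 1 / 2) * (2 * (ρ / 4)) ^ m) ≤ (1 + 1 / 2) * (4 * R) ^ m :=
    h2.trans (h1.trans h3)
  have e1 : (2 * (ρ / 4)) ^ m = ρ ^ m / 2 ^ m := by rw [← div_pow]; ring_nf
  have e2 : (8 : ℝ) ^ m = 2 ^ m * 4 ^ m := by rw [← mul_pow]; norm_num
  rw [e1, mul_pow] at h4
  have h5 : (0 : ℝ) < 2 ^ m := by positivity
  have h6 : (T.card : ℝ) * ρ ^ m = (T.card : ℝ) * ((1 - 1 / 2) * (ρ ^ m / 2 ^ m)) * (2 * 2 ^ m) := by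
    field_simp; ring
  rw [h6, e2]
  calc _ ≤ (1 + 1 / 2) * (4 ^ m * R ^ m) * (2 * 2 ^ m) := by gcongr
    _ = _ := by ring

/-- A cover of the limit set eventually covers `F k` in the unit ball, since otherwise uncovered
points would have an uncovered limit. The covering balls then carry nearly all the mass of the unit
ball, at most `(5 / 4) (2 ρ t) ^ m` each. -/
theorem IsAsymptoticallyUniform.covering [ProperSpace X] {l : Ultrafilter ℕ}
    (h : IsAsymptoticallyUniform l m ν F) (T : Finset X) (ρ : X → ℝ) (hρ : ∀ t ∈ T, 0 < ρ t)
    (hcov : limitSet l F ∩ Metric.closedBall 0 1 ⊆ ⋃ t ∈ T, Metric.ball t (ρ t)) :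
    1 / (4 * 2 ^ m) ≤ ∑ t ∈ T, ρ t ^ m := by
  have hev : ∀ᶠ k in (l : Filter ℕ), F k ∩ Metric.closedBall 0 1 ⊆ ⋃ t ∈ T, Metric.ball t (ρ t) := by
    by_contra hcon
    rw [← Ultrafilter.eventually_not] at hcon
    have hch : ∀ k, ¬ (F k ∩ Metric.closedBall 0 1 ⊆ ⋃ t ∈ T, Metric.ball t (ρ t)) →
        ∃ z, z ∈ F k ∧ ‖z‖ ≤ 1 ∧ z ∉ ⋃ t ∈ T, Metric.ball t (ρ t) := by
      intro k hk
      obtain ⟨z, ⟨h1, h2⟩, h3⟩ := Set.not_subset.1 hk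
      exact ⟨z, h1, by simpa using h2, h3⟩
    choose! z hzF hz1 hz using hch
    obtain ⟨y, hy, hy1, hzy⟩ := exists_mem_limitSet_of_bounded (F := F) (z := z) (R := 1)
      (by filter_upwards [hcon] with k hk using ⟨hzF k hk, hz1 k hk⟩)
    have hopen : IsOpen (⋃ t ∈ T, Metric.ball t (ρ t)) :=
      isOpen_biUnion fun _ _ => Metric.isOpen_ball
    have hyU := hcov ⟨hy, by simpa using hy1⟩
    obtain ⟨k, hk, hk'⟩ := ((hzy.eventually (hopen.mem_nhds hyU)).and hcon).exists
    exact hz k hk' hk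
  have hρ0 : ∀ t ∈ T, 0 ≤ ρ t := fun t ht => (hρ t ht).le
  set R := ∑ t ∈ T, 2 * ρ t + 1 with hR
  have hTR : ∀ t ∈ T, 2 * ρ t ≤ R := fun t ht => by
    have := Finset.single_le_sum (f := fun t => 2 * ρ t)
      (fun t ht => by have := hρ0 t ht; positivity) ht
    linarith
  have hR1 : 1 ≤ R := by
    have : 0 ≤ ∑ t ∈ T, 2 * ρ t := Finset.sum_nonneg fun t ht => by
      have := hρ0 t ht; positivity
    linarith
  obtain ⟨k, ⟨⟨hlow, hup⟩, hcom⟩, hk⟩ := ((h.lower (1 / 4) (by norm_num) R).and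
    (h.upper (1 / 4) (by norm_num) R) |>.and (h.compl (1 / 4) (by norm_num) 1 one_pos)
    |>.and hev).exists
  have := h.finite k
  have h1 := hlow 0 (h.zero_mem k) 1 one_pos hR1
  have hsub : Metric.ball 0 1 ⊆ (Metric.ball 0 1 \ F k) ∪ ⋃ t ∈ T, F k ∩ Metric.ball t (ρ t) := by
    intro x hx
    by_cases hxF : x ∈ F k
    · right
      obtain ⟨t, ht, hxt⟩ := Set.mem_iUnion₂.1 (hk ⟨hxF, Metric.ball_subset_closedBall hx⟩)
      exact Set.mem_iUnion₂.2 ⟨t, ht, hxF, hxt⟩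
    · exact Or.inl ⟨hx, hxF⟩
  have h2 : (ν k).real (⋃ t ∈ T, F k ∩ Metric.ball t (ρ t)) ≤
      ∑ t ∈ T, (1 + 1 / 4) * (2 * ρ t) ^ m := by
    refine (measureReal_biUnion_finset_le _ _).trans (Finset.sum_le_sum fun t ht => ?_)
    rcases (F k ∩ Metric.ball t (ρ t)).eq_empty_or_nonempty with he | ⟨z, hz⟩
    · rw [he, measureReal_empty]
      have := hρ0 t ht
      positivity
    · refine hup _ ((h.measurableSet k).inter Metric.isOpen_ball.measurableSet) z hz hz.1 _
        (by have := hρ t ht; positivity) (hTR t ht) fun p hp q hq => ?_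
      have h3 := hp.2
      have h4 := hq.2
      rw [Metric.mem_ball] at h3 h4
      rw [← dist_eq_norm]
      linarith [dist_triangle_right p q t]
  have h3 := (measureReal_mono (μ := ν k) hsub).trans (measureReal_union_le _ _)
  have h4 : (1 : ℝ) ≤ 2 ^ m := one_le_pow₀ (by norm_num)
  have h5 : ∑ t ∈ T, (1 + 1 / 4) * (2 * ρ t) ^ m = (5 / 4) * 2 ^ m * ∑ t ∈ T, ρ t ^ m := by
    rw [Finset.mul_sum]
    refine Finset.sum_congr rfl fun t _ => ?_
    rw [mul_pow]; ring
  rw [h5] at h2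
  rw [mul_one] at h1
  rw [div_le_iff₀ (by positivity)]
  nlinarith

theorem IsAsymptoticallyUniform.exists_submodule [NormedSpace ℝ X] [FiniteDimensional ℝ X]
    [StrictConvexSpace ℝ X] {l : Ultrafilter ℕ} (h : IsAsymptoticallyUniform l m ν F) :
    ∃ W : Submodule ℝ X, Module.finrank ℝ W = m ∧ limitSet l F = W := by
  have : ProperSpace X := FiniteDimensional.proper ℝ X
  exact exists_submodule_eq_of_reflection (isClosed_limitSet _ _) h.zero_mem_limitSet
    (fun y hy z hz => h.reflection_mem hy hz) (c := 1 / (4 * 2 ^ m)) (by positivity) h.packing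
    h.covering

end Limits

/-! ### Flatness at small scales -/

section Flat

variable {X : Type*} [NormedAddCommGroup X] [MeasurableSpace X]

/-- Uniform density conditions at small scales: at points of `F` the measure `μ` has `m`-density
one and upper convex density at most one, and `F` has full density at points of `F'`. -/
structure HasUniformDensity (μ : Measure X) (m : ℕ) (F F' : Set X) : Prop where
  measurableSet : MeasurableSet F
  subset : F' ⊆ F
  lower : ∀ δ > 0, ∃ r₀ > 0, ∀ x ∈ F, ∀ r : ℝ, 0 < r → r < r₀ →
    (1 - δ) * (2 * r) ^ m ≤ μ.real (Metric.ball x r)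
  upper : ∀ δ > 0, ∃ r₀ > 0, ∀ x ∈ F, ∀ U : Set X, x ∈ U → ∀ D : ℝ, 0 < D → D < r₀ →
    (∀ p ∈ U, ∀ q ∈ U, dist p q ≤ D) → μ.real U ≤ (1 + δ) * D ^ m
  compl : ∀ δ > 0, ∃ r₀ > 0, ∀ x ∈ F', ∀ r : ℝ, 0 < r → r < r₀ →
    μ.real (Metric.ball x r \ F) ≤ δ * r ^ m

/-- `F` is, near every point of `F'` and at every small scale, close to an `m`-dimensional plane. -/
def IsFlatAt [NormedSpace ℝ X] (m : ℕ) (F F' : Set X) : Prop :=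
  ∀ ε > 0, ∃ r₀ > 0, ∀ x ∈ F', ∀ r : ℝ, 0 < r → r < r₀ → ∃ W : Submodule ℝ X,
    Module.finrank ℝ W = m ∧ (∀ y ∈ F, ‖y - x‖ ≤ r → ∃ w ∈ W, ‖y - x - w‖ ≤ ε * r) ∧
    ∀ w ∈ W, ‖w‖ ≤ r → ∃ q ∈ F, ‖q - x - w‖ ≤ ε * r

variable [NormedSpace ℝ X] [BorelSpace X] {m : ℕ} {μ : Measure X} {F F' : Set X}

/-- All the density bounds are homogeneous of degree `m`, so magnifying by `1 / r k` and dividing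
mass by `r k ^ m` keeps their constants while the admissible scales become unbounded. -/
theorem HasUniformDensity.isAsymptoticallyUniform [IsFiniteMeasure μ]
    (h : HasUniformDensity μ m F F') {l : Filter ℕ} {x : ℕ → X} {r : ℕ → ℝ} (hx : ∀ k, x k ∈ F')
    (hr : ∀ k, 0 < r k) (hr0 : Tendsto r l (𝓝 0)) :
    IsAsymptoticallyUniform l m
      (fun k => Real.toNNReal ((r k ^ m)⁻¹) • μ.map (fun p => (r k)⁻¹ • (p - x k)))
      (fun k => {z | x k + r k • z ∈ F}) := by
  have hcont : ∀ k, Continuous fun p : X => (r k)⁻¹ • (p - x k) := fun k => by fun_prop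
  have hreal : ∀ k, ∀ U : Set X, MeasurableSet U →
      (Real.toNNReal ((r k ^ m)⁻¹) • μ.map (fun p => (r k)⁻¹ • (p - x k))).real U =
        (r k ^ m)⁻¹ * μ.real ((fun p => (r k)⁻¹ • (p - x k)) ⁻¹' U) := by
    intro k U hU
    have := hr k
    rw [measureReal_nnreal_smul_apply, map_measureReal_apply (hcont k).measurable hU,
      Real.coe_toNNReal _ (by positivity)]
  have hinv : ∀ k, ∀ p : X, x k + r k • (r k)⁻¹ • (p - x k) = p := fun k p => by
    rw [smul_inv_smul₀ (hr k).ne', add_sub_cancel]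
  have hball : ∀ k, ∀ z : X, ∀ ρ : ℝ, (fun p => (r k)⁻¹ • (p - x k)) ⁻¹' Metric.ball z ρ =
      Metric.ball (x k + r k • z) (r k * ρ) := by
    intro k z ρ
    ext p
    have e : (r k)⁻¹ • (p - x k) - z = (r k)⁻¹ • (p - (x k + r k • z)) := by
      rw [← sub_sub, smul_sub _ _ (r k • z), inv_smul_smul₀ (hr k).ne']
    rw [Set.mem_preimage, mem_ball_iff_norm, mem_ball_iff_norm, e, norm_smul, norm_inv,
      Real.norm_of_nonneg (hr k).le, inv_mul_lt_iff₀ (hr k)]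
  have hsmall : ∀ R : ℝ, ∀ r₀ > 0, ∀ᶠ k in l, r k * R < r₀ := fun R r₀ hr₀ => by
    have := hr0.mul_const R
    rw [zero_mul] at this
    exact this.eventually_lt_const hr₀
  refine ⟨fun k => inferInstance, fun k => ?_, fun k => ?_, fun δ hδ R => ?_, fun δ hδ R => ?_,
    fun δ hδ R hR => ?_⟩
  · have : Continuous fun z : X => x k + r k • z := by fun_prop
    exact this.measurable h.measurableSet
  · simpa using h.subset (hx k)
  · obtain ⟨r₀, hr₀, hlow⟩ := h.lower δ hδ
    filter_upwards [hsmall R r₀ hr₀] with k hk z hz ρ hρ hρR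
    have hrk := hr k
    rw [hreal k _ Metric.isOpen_ball.measurableSet, hball]
    have h1 := hlow _ hz (r k * ρ) (by positivity)
      (lt_of_le_of_lt (mul_le_mul_of_nonneg_left hρR hrk.le) hk)
    rw [le_inv_mul_iff₀ (by positivity)]
    refine le_trans (le_of_eq ?_) h1
    rw [mul_left_comm 2, mul_pow (r k)]
    ring
  · obtain ⟨r₀, hr₀, hup⟩ := h.upper δ hδ
    filter_upwards [hsmall R r₀ hr₀] with k hk U hU z hzU hzF D hD hDR hUD
    have hrk := hr k
    rw [hreal k _ hU]
    have h1 := hup (x k + r k • z) hzF ((fun p => (r k)⁻¹ • (p - x k)) ⁻¹' U) ?_ (r k * D) (by positivity)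
      (lt_of_le_of_lt (mul_le_mul_of_nonneg_left hDR hrk.le) hk) ?_
    · rw [inv_mul_le_iff₀ (by positivity)]
      refine h1.trans (le_of_eq ?_)
      rw [mul_pow]; ring
    · change (r k)⁻¹ • (x k + r k • z - x k) ∈ U
      rwa [add_sub_cancel_left, inv_smul_smul₀ hrk.ne']
    · intro p hp q hq
      have h2 := hUD _ hp _ hq
      rw [← smul_sub, sub_sub_sub_cancel_right, norm_smul, norm_inv, Real.norm_of_nonneg hrk.le,
        inv_mul_le_iff₀ hrk] at h2
      rwa [dist_eq_norm]
  · obtain ⟨r₀, hr₀, hcom⟩ := h.compl (δ / R ^ m) (by positivity)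
    filter_upwards [hsmall R r₀ hr₀] with k hk
    have hrk := hr k
    have hF : MeasurableSet {z | x k + r k • z ∈ F} := by
      have : Continuous fun z : X => x k + r k • z := by fun_prop
      exact this.measurable h.measurableSet
    rw [hreal k _ (Metric.isOpen_ball.measurableSet.diff hF), Set.preimage_sdiff, hball]
    have e : (fun p => (r k)⁻¹ • (p - x k)) ⁻¹' {z | x k + r k • z ∈ F} = F := by
      ext p
      change x k + r k • (r k)⁻¹ • (p - x k) ∈ F ↔ p ∈ F
      rw [hinv]
    rw [e, smul_zero, add_zero, inv_mul_le_iff₀ (by positivity)]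
    refine (hcom _ (hx k) _ (by positivity) hk).trans (le_of_eq ?_)
    rw [mul_pow]
    field_simp

/-- If flatness failed for some `ε` at scales `r k → 0`, the blow-ups along an ultrafilter would
converge to a plane `W`; local convergence in both directions makes `W` itself a valid plane for
some `k`. -/
theorem HasUniformDensity.isFlatAt [FiniteDimensional ℝ X] [StrictConvexSpace ℝ X]
    [IsFiniteMeasure μ] (h : HasUniformDensity μ m F F') : IsFlatAt m F F' := by
  have : ProperSpace X := FiniteDimensional.proper ℝ X
  intro ε hε
  by_contra! hcon
  have hcon' := fun n : ℕ => hcon (1 / (n + 1)) (by positivity)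
  choose x hx r hr hr1 hbad using hcon'
  have hr0 : Tendsto r atTop (𝓝 0) :=
    squeeze_zero (fun n => (hr n).le) (fun n => (hr1 n).le) tendsto_one_div_add_atTop_nhds_zero_nat
  let l : Ultrafilter ℕ := hyperfilter ℕ
  have hl : (l : Filter ℕ) ≤ atTop := by
    rw [← Nat.cofinite_eq_atTop]; exact hyperfilter_le_cofinite
  have hunif := h.isAsymptoticallyUniform hx hr (hr0.mono_left hl)
  obtain ⟨W, hW, hS⟩ := hunif.exists_submodule
  have hinv : ∀ k, ∀ p : X, x k + r k • (r k)⁻¹ • (p - x k) = p := fun k p => by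
    rw [smul_inv_smul₀ (hr k).ne', add_sub_cancel]
  have h1 : ∀ᶠ k in (l : Filter ℕ), ∀ y ∈ F, ‖y - x k‖ ≤ r k → ∃ w ∈ W, ‖y - x k - w‖ ≤ ε * r k := by
    by_contra hneg
    rw [← Ultrafilter.eventually_not] at hneg
    have hch : ∀ k, ¬ (∀ y ∈ F, ‖y - x k‖ ≤ r k → ∃ w ∈ W, ‖y - x k - w‖ ≤ ε * r k) →
        ∃ y ∈ F, ‖y - x k‖ ≤ r k ∧ ∀ w ∈ W, ε * r k < ‖y - x k - w‖ := by
      intro k hk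
      push Not at hk
      exact hk
    choose! y hyF hyr hyW using hch
    obtain ⟨z, hz, -, hzt⟩ := exists_mem_limitSet_of_bounded (l := l)
      (F := fun k => {z | x k + r k • z ∈ F}) (z := fun k => (r k)⁻¹ • (y k - x k)) (R := 1) (by
        filter_upwards [hneg] with k hk
        refine ⟨?_, ?_⟩
        · rw [hinv]; exact hyF k hk
        · rw [norm_smul, norm_inv, Real.norm_of_nonneg (hr k).le, inv_mul_le_iff₀ (hr k), mul_one]
          exact hyr k hk)
    rw [hS] at hz
    obtain ⟨k, hk, hk'⟩ := (hneg.and (Metric.tendsto_nhds.1 hzt ε hε)).exists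
    have h2 := hyW k hk (r k • z) (W.smul_mem _ hz)
    have e : y k - x k - r k • z = r k • ((r k)⁻¹ • (y k - x k) - z) := by
      rw [smul_sub, smul_inv_smul₀ (hr k).ne']
    rw [e, norm_smul, Real.norm_of_nonneg (hr k).le, mul_comm ε] at h2
    rw [dist_eq_norm] at hk'
    exact absurd (lt_of_mul_lt_mul_left h2 (hr k).le) hk'.not_gt
  have h2 : ∀ᶠ k in (l : Filter ℕ), ∀ w ∈ W, ‖w‖ ≤ r k → ∃ q ∈ F, ‖q - x k - w‖ ≤ ε * r k := by
    by_contra hneg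
    rw [← Ultrafilter.eventually_not] at hneg
    have hch : ∀ k, ¬ (∀ w ∈ W, ‖w‖ ≤ r k → ∃ q ∈ F, ‖q - x k - w‖ ≤ ε * r k) →
        ∃ w ∈ W, ‖w‖ ≤ r k ∧ ∀ q ∈ F, ε * r k < ‖q - x k - w‖ := by
      intro k hk
      push Not at hk
      exact hk
    choose! w hwW hwr hwq using hch
    obtain ⟨z, hz, -, hzt⟩ := exists_mem_limitSet_of_bounded (l := l)
      (F := fun _ => (W : Set X)) (z := fun k => (r k)⁻¹ • w k) (R := 1) (by
        filter_upwards [hneg] with k hk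
        refine ⟨W.smul_mem _ (hwW k hk), ?_⟩
        rw [norm_smul, norm_inv, Real.norm_of_nonneg (hr k).le, inv_mul_le_iff₀ (hr k), mul_one]
        exact hwr k hk)
    have hzW : z ∈ W := by
      have hcl : IsClosed (W : Set X) := W.closed_of_finiteDimensional
      exact hcl.mem_of_tendsto hzt (hneg.mono fun k hk => W.smul_mem _ (hwW k hk))
    have hzS : z ∈ limitSet (l : Filter ℕ) fun k => {z | x k + r k • z ∈ F} := by
      rw [hS]; exact hzW
    obtain ⟨k, ⟨hk, hk'⟩, q, hqF, hqz⟩ := ((hneg.and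
      (Metric.tendsto_nhds.1 hzt (ε / 2) (by positivity))).and (hzS (ε / 2) (by positivity))).exists
    have h3 := hwq k hk (x k + r k • q) hqF
    have e : x k + r k • q - x k - w k = r k • ((q - z) - ((r k)⁻¹ • w k - z)) := by
      rw [sub_sub_sub_cancel_right, smul_sub, smul_inv_smul₀ (hr k).ne', add_sub_cancel_left]
    rw [e, norm_smul, Real.norm_of_nonneg (hr k).le, mul_comm ε] at h3
    have h4 := lt_of_mul_lt_mul_left h3 (hr k).le
    have h5 := norm_sub_le (q - z) ((r k)⁻¹ • w k - z)
    rw [dist_eq_norm] at hk'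
    linarith
  obtain ⟨k, hk1, hk2⟩ := (h1.and h2).exists
  obtain ⟨w, hwW, hwr, hw⟩ := hbad k W hW hk1
  obtain ⟨q, hqF, hq⟩ := hk2 w hwW hwr
  exact absurd hq (hw q hqF).not_ge

end Flat

/-! ### Uniform densities on large compact sets -/

/-- Egorov's argument: choose each `n j` with exceptional set below the `j`-th term of a series with
sum below `η`. -/
theorem exists_measure_compl_iInter_le {X : Type*} [MeasurableSpace X] {μ : Measure X}
    [IsFiniteMeasure μ] {G : ℕ → ℕ → Set X} (hG : ∀ j n, MeasurableSet (G j n))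
    (hmono : ∀ j, Monotone (G j)) (hae : ∀ j, ∀ᵐ x ∂μ, ∃ n, x ∈ G j n) {η : ℝ≥0∞} (hη : η ≠ 0) :
    ∃ n : ℕ → ℕ, μ (⋂ j, G j (n j))ᶜ ≤ η := by
  obtain ⟨ε, hε, hsum⟩ := ENNReal.exists_pos_sum_of_countable' hη ℕ
  have h : ∀ j, ∃ n, μ (G j n)ᶜ < ε j := by
    intro j
    have ht := tendsto_measure_iInter_atTop (μ := μ) (s := fun n => (G j n)ᶜ)
      (fun n => (hG j n).compl.nullMeasurableSet)
      (fun a b hab => Set.compl_subset_compl.2 (hmono j hab)) ⟨0, measure_ne_top _ _⟩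
    have h0 : μ (⋂ n, (G j n)ᶜ) = 0 := by
      rw [← Set.compl_iUnion]
      refine measure_mono_null (fun x hx => ?_) (hae j)
      simpa using hx
    rw [h0] at ht
    exact (ht.eventually_lt_const (hε j)).exists
  choose n hn using h
  refine ⟨n, ?_⟩
  rw [Set.compl_iInter]
  exact (measure_iUnion_le _).trans ((ENNReal.tsum_le_tsum fun j => (hn j).le).trans hsum.le)

section Closed

variable {X : Type*} [MetricSpace X] [MeasurableSpace X] {μ : Measure X} [IsFiniteMeasure μ]

theorem isClosed_setOf_lower_density (m : ℕ) (δ ρ : ℝ) :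
    IsClosed {x : X | ∀ r : ℝ, 0 < r → r < ρ →
      (1 - δ) * (2 * r) ^ m ≤ μ.real (Metric.ball x r)} := by
  refine isClosed_of_closure_subset fun x hx r hr hrρ => ?_
  have hcont : Continuous fun s : ℝ => (1 - δ) * (2 * s) ^ m := by fun_prop
  refine le_of_tendsto ((hcont.tendsto r).mono_left (nhdsWithin_le_nhds (s := Set.Iio r))) ?_
  filter_upwards [Ioo_mem_nhdsLT hr] with s hs
  obtain ⟨y, hy, hyx⟩ := Metric.mem_closure_iff.1 hx (r - s) (sub_pos.2 hs.2)
  refine (hy s hs.1 (hs.2.trans hrρ)).trans (measureReal_mono (Metric.ball_subset_ball' ?_))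
  rw [dist_comm]
  linarith

/-- Adjoining to `U` a nearby point of the set enlarges the diameter bound from `D` only to `s`;
then `s` decreases to `D`. -/
theorem isClosed_setOf_upper_density (m : ℕ) (δ ρ : ℝ) :
    IsClosed {x : X | ∀ U : Set X, x ∈ U → ∀ D : ℝ, 0 < D → D < ρ →
      (∀ p ∈ U, ∀ q ∈ U, dist p q ≤ D) → μ.real U ≤ (1 + δ) * D ^ m} := by
  refine isClosed_of_closure_subset fun x hx U hxU D hD hDρ hU => ?_
  have hcont : Continuous fun s : ℝ => (1 + δ) * s ^ m := by fun_prop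
  refine ge_of_tendsto ((hcont.tendsto D).mono_left (nhdsWithin_le_nhds (s := Set.Ioi D))) ?_
  filter_upwards [Ioo_mem_nhdsGT hDρ] with s hs
  obtain ⟨y, hy, hxy⟩ := Metric.mem_closure_iff.1 hx (s - D) (sub_pos.2 hs.1)
  have hyU : ∀ p ∈ U, dist p y ≤ s := fun p hp => by
    have := dist_triangle p x y
    have := hU p hp x hxU
    linarith
  refine (measureReal_mono (Set.subset_insert y U)).trans
    (hy (insert y U) (Set.mem_insert _ _) s (hD.trans hs.1) hs.2 ?_)
  rintro p (rfl | hp) q (rfl | hq)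
  · rw [dist_self]; exact (hD.trans hs.1).le
  · rw [dist_comm]; exact hyU q hq
  · exact hyU p hp
  · exact (hU p hp q hq).trans hs.1.le

/-- Passing to the closure, which makes the set measurable, costs only a doubling of the radius. -/
theorem measureReal_ball_diff_le_of_mem_closure {m : ℕ} {δ ρ : ℝ} {F : Set X} {x : X}
    (hx : x ∈ closure {x : X | ∀ r : ℝ, 0 < r → r < ρ → μ.real (Metric.ball x r \ F) ≤ δ * r ^ m})
    {r : ℝ} (hr : 0 < r) (hrρ : 2 * r < ρ) :
    μ.real (Metric.ball x r \ F) ≤ δ * (2 * r) ^ m := by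
  obtain ⟨y, hy, hyx⟩ := Metric.mem_closure_iff.1 hx r hr
  refine (measureReal_mono (Set.sdiff_subset_sdiff_left (Metric.ball_subset_ball' ?_))).trans
    (hy (2 * r) (by positivity) hrρ)
  linarith

end Closed

/-- Lebesgue density bounds the mass off `F` relative to the mass of the ball; the upper density
bound on `F` converts this to a multiple of `r ^ m`. -/
theorem ae_measureReal_ball_diff_le {X : Type*} [NormedAddCommGroup X] [NormedSpace ℝ X]
    [FiniteDimensional ℝ X] [MeasurableSpace X] [BorelSpace X] {μ : Measure X} [IsFiniteMeasure μ]
    {m : ℕ} {F : Set X} (hF : MeasurableSet F)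
    (hup : ∀ x ∈ F, ∀ δ > 0, ∃ r₀ > 0, ∀ U : Set X, x ∈ U → ∀ D : ℝ, 0 < D → D < r₀ →
      (∀ p ∈ U, ∀ q ∈ U, dist p q ≤ D) → μ.real U ≤ (1 + δ) * D ^ m) {δ : ℝ} (hδ : 0 < δ) :
    ∀ᵐ x ∂μ, x ∈ F → ∃ r₀ > 0, ∀ r : ℝ, 0 < r → r < r₀ →
      μ.real (Metric.ball x r \ F) ≤ δ * r ^ m := by
  filter_upwards [Besicovitch.ae_tendsto_measure_inter_div_of_measurableSet μ hF.compl] with x hx hxF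
  rw [Set.indicator_of_notMem (by simpa using hxF)] at hx
  obtain ⟨r₁, hr₁, h1⟩ := hup x hxF 1 one_pos
  set c : ℝ := δ / (2 * 2 ^ m) with hc
  have hcpos : 0 < c := by positivity
  obtain ⟨r₂, hr₂, h2⟩ := mem_nhdsGT_iff_exists_Ioo_subset.1
    (hx.eventually_lt_const (show (0 : ℝ≥0∞) < ENNReal.ofReal c by simpa using hcpos))
  have hr₂ : 0 < r₂ := hr₂
  refine ⟨min (r₁ / 2) r₂, by positivity, fun r hr hrr => ?_⟩
  rw [lt_min_iff] at hrr
  have h3 : μ (Fᶜ ∩ Metric.closedBall x r) / μ (Metric.closedBall x r) < ENNReal.ofReal c :=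
    h2 ⟨hr, hrr.2⟩
  have h4 := (ENNReal.div_le_iff_le_mul (Or.inr ENNReal.ofReal_ne_top)
    (Or.inl (measure_ne_top _ _))).1 h3.le
  have h5 : μ.real (Fᶜ ∩ Metric.closedBall x r) ≤ c * μ.real (Metric.closedBall x r) := by
    have := ENNReal.toReal_mono (ENNReal.mul_ne_top ENNReal.ofReal_ne_top (measure_ne_top _ _)) h4
    rwa [ENNReal.toReal_mul, ENNReal.toReal_ofReal hcpos.le] at this
  have h6 := h1 (Metric.closedBall x r) (Metric.mem_closedBall_self hr.le) (2 * r) (by positivity)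
    (by linarith) (fun p hp q hq => by
      rw [Metric.mem_closedBall] at hp hq
      linarith [dist_triangle_right p q x])
  calc μ.real (Metric.ball x r \ F) ≤ μ.real (Fᶜ ∩ Metric.closedBall x r) :=
        measureReal_mono fun y hy => ⟨hy.2, Metric.ball_subset_closedBall hy.1⟩
    _ ≤ c * ((1 + 1) * (2 * r) ^ m) := h5.trans (by gcongr)
    _ = δ * r ^ m := by rw [hc, mul_pow]; field_simp; ring

/-- Four losses of `η / 4`: uniform lower density, uniform upper density, inner regularity for `F`,
and uniform full density of `F` for `F'`. -/
theorem exists_isCompact_hasUniformDensity {X : Type*} [NormedAddCommGroup X] [NormedSpace ℝ X]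
    [FiniteDimensional ℝ X] [MeasurableSpace X] [BorelSpace X] {μ : Measure X} [IsFiniteMeasure μ]
    {m : ℕ} {E : Set X} (hE : μ Eᶜ = 0)
    (hlow : ∀ᵐ x ∂μ, ∀ δ > 0, ∃ r₀ > 0, ∀ r : ℝ, 0 < r → r < r₀ →
      (1 - δ) * (2 * r) ^ m ≤ μ.real (Metric.ball x r))
    (hup : ∀ᵐ x ∂μ, ∀ δ > 0, ∃ r₀ > 0, ∀ U : Set X, x ∈ U → ∀ D : ℝ, 0 < D → D < r₀ →
      (∀ p ∈ U, ∀ q ∈ U, dist p q ≤ D) → μ.real U ≤ (1 + δ) * D ^ m) {η : ℝ≥0∞} (hη : η ≠ 0) :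
    ∃ F F' : Set X, F ⊆ E ∧ IsCompact F' ∧ HasUniformDensity μ m F F' ∧ μ F'ᶜ ≤ η := by
  have : ProperSpace X := FiniteDimensional.proper ℝ X
  have hη4 : η / 4 ≠ 0 := by simpa using hη
  have hδ : ∀ j : ℕ, (0 : ℝ) < 1 / (j + 1) := fun j => by positivity
  have hle : ∀ {n n' : ℕ}, n ≤ n' → (1 : ℝ) / (n' + 1) ≤ 1 / (n + 1) := fun h =>
    one_div_le_one_div_of_le (by positivity) (by exact_mod_cast Nat.succ_le_succ h)
  let G₁ : ℕ → ℕ → Set X := fun j n => {x : X | ∀ r : ℝ, 0 < r → r < 1 / ((n : ℝ) + 1) →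
      (1 - 1 / ((j : ℝ) + 1)) * (2 * r) ^ m ≤ μ.real (Metric.ball x r)}
  let G₂ : ℕ → ℕ → Set X := fun j n => {x : X | ∀ U : Set X, x ∈ U → ∀ D : ℝ, 0 < D →
      D < 1 / ((n : ℝ) + 1) → (∀ p ∈ U, ∀ q ∈ U, dist p q ≤ D) →
      μ.real U ≤ (1 + 1 / ((j : ℝ) + 1)) * D ^ m}
  have hG₁ : ∀ j n, IsClosed (G₁ j n) := fun j n => isClosed_setOf_lower_density m _ _
  have hG₂ : ∀ j n, IsClosed (G₂ j n) := fun j n => isClosed_setOf_upper_density m _ _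
  obtain ⟨n₁, hn₁⟩ := exists_measure_compl_iInter_le (μ := μ) (G := G₁)
    (fun j n => (hG₁ j n).measurableSet)
    (fun j n n' hnn x hx r hr hrn => hx r hr (hrn.trans_le (hle hnn)))
    (fun j => by
      filter_upwards [hlow] with x hx
      obtain ⟨r₀, hr₀, h⟩ := hx _ (hδ j)
      obtain ⟨n, hn⟩ := exists_nat_one_div_lt hr₀
      exact ⟨n, fun r hr hrn => h r hr (hrn.trans hn)⟩) hη4
  obtain ⟨n₂, hn₂⟩ := exists_measure_compl_iInter_le (μ := μ) (G := G₂)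
    (fun j n => (hG₂ j n).measurableSet)
    (fun j n n' hnn x hx U hxU D hD hDn => hx U hxU D hD (hDn.trans_le (hle hnn)))
    (fun j => by
      filter_upwards [hup] with x hx
      obtain ⟨r₀, hr₀, h⟩ := hx _ (hδ j)
      obtain ⟨n, hn⟩ := exists_nat_one_div_lt hr₀
      exact ⟨n, fun U hxU D hD hDn => h U hxU D hD (hDn.trans hn)⟩) hη4
  set F₁ := ⋂ j, G₁ j (n₁ j)
  set F₂ := ⋂ j, G₂ j (n₂ j)
  set E' := (toMeasurable μ Eᶜ)ᶜ with hE'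
  have hE'm : MeasurableSet E' := (measurableSet_toMeasurable _ _).compl
  have hE'E : E' ⊆ E := Set.compl_subset_comm.1 (subset_toMeasurable _ _)
  have hm : MeasurableSet (E' ∩ (F₁ ∩ F₂)) :=
    hE'm.inter ((isClosed_iInter fun j => hG₁ j _).inter
      (isClosed_iInter fun j => hG₂ j _)).measurableSet
  obtain ⟨F, hFsub, hFc, hFη⟩ := hm.exists_isCompact_sdiff_lt (measure_ne_top μ _) hη4
  have hlowF : ∀ δ > 0, ∃ r₀ > 0, ∀ x ∈ F, ∀ r : ℝ, 0 < r → r < r₀ →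
      (1 - δ) * (2 * r) ^ m ≤ μ.real (Metric.ball x r) := by
    intro δ hδ'
    obtain ⟨j, hj⟩ := exists_nat_one_div_lt hδ'
    refine ⟨_, hδ (n₁ j), fun x hx r hr hrn => le_trans ?_
      (Set.mem_iInter.1 (hFsub hx).2.1 j r hr hrn)⟩
    gcongr
  have hupF : ∀ δ > 0, ∃ r₀ > 0, ∀ x ∈ F, ∀ U : Set X, x ∈ U → ∀ D : ℝ, 0 < D → D < r₀ →
      (∀ p ∈ U, ∀ q ∈ U, dist p q ≤ D) → μ.real U ≤ (1 + δ) * D ^ m := by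
    intro δ hδ'
    obtain ⟨j, hj⟩ := exists_nat_one_div_lt hδ'
    refine ⟨_, hδ (n₂ j), fun x hx U hxU D hD hDn hU =>
      (Set.mem_iInter.1 (hFsub hx).2.2 j U hxU D hD hDn hU).trans ?_⟩
    gcongr
  let A : ℕ → ℕ → Set X := fun j n => closure {x : X | ∀ r : ℝ, 0 < r → r < 1 / ((n : ℝ) + 1) →
    μ.real (Metric.ball x r \ F) ≤ 1 / ((j : ℝ) + 1) * r ^ m}
  -- Adding `Fᶜ` makes the condition hold almost everywhere on the whole space, as Egorov's argument
  -- requires.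
  obtain ⟨n₃, hn₃⟩ := exists_measure_compl_iInter_le (μ := μ) (G := fun j n => A j n ∪ Fᶜ)
    (fun j n => isClosed_closure.measurableSet.union hFc.isClosed.measurableSet.compl)
    (fun j n n' hnn => Set.union_subset_union_left _
      (closure_mono fun x hx r hr hrn => hx r hr (hrn.trans_le (hle hnn))))
    (fun j => by
      filter_upwards [ae_measureReal_ball_diff_le hFc.isClosed.measurableSet
        (fun x hx δ hδ' => by
          obtain ⟨r₀, hr₀, h⟩ := hupF δ hδ'
          exact ⟨r₀, hr₀, h x hx⟩) (hδ j)] with x hx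
      by_cases hxF : x ∈ F
      · obtain ⟨r₀, hr₀, h⟩ := hx hxF
        obtain ⟨n, hn⟩ := exists_nat_one_div_lt hr₀
        exact ⟨n, Or.inl (subset_closure fun r hr hrn => h r hr (hrn.trans hn))⟩
      · exact ⟨0, Or.inr hxF⟩) hη4
  refine ⟨F, F ∩ ⋂ j, A j (n₃ j), fun x hx => hE'E (hFsub hx).1,
    hFc.inter_right (isClosed_iInter fun j => isClosed_closure),
    ⟨hFc.isClosed.measurableSet, Set.inter_subset_left, hlowF, hupF, fun δ hδ' => ?_⟩, ?_⟩
  · obtain ⟨j, hj⟩ := exists_nat_one_div_lt (show 0 < δ / 2 ^ m by positivity)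
    refine ⟨1 / ((n₃ j : ℝ) + 1) / 2, by positivity, fun x hx r hr hrn => ?_⟩
    refine (measureReal_ball_diff_le_of_mem_closure (Set.mem_iInter.1 hx.2 j) hr
      (by linarith)).trans ?_
    calc 1 / ((j : ℝ) + 1) * (2 * r) ^ m ≤ δ / 2 ^ m * (2 * r) ^ m := by gcongr
      _ = δ * r ^ m := by rw [mul_pow]; field_simp
  · have hsub : (F ∩ ⋂ j, A j (n₃ j))ᶜ ⊆
        (E'ᶜ ∪ F₁ᶜ ∪ F₂ᶜ ∪ ((E' ∩ (F₁ ∩ F₂)) \ F)) ∪ (⋂ j, (A j (n₃ j) ∪ Fᶜ))ᶜ := by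
      intro x hx
      by_cases hxF : x ∈ F
      · refine Or.inr fun hx' => hx ⟨hxF, Set.mem_iInter.2 fun j => ?_⟩
        exact (Set.mem_iInter.1 hx' j).resolve_right (fun h => h hxF)
      · left
        by_cases h0 : x ∈ E'
        · by_cases h1 : x ∈ F₁
          · by_cases h2 : x ∈ F₂
            · exact Or.inr ⟨⟨h0, h1, h2⟩, hxF⟩
            · exact Or.inl (Or.inr h2)
          · exact Or.inl (Or.inl (Or.inr h1))
        · exact Or.inl (Or.inl (Or.inl h0))
    have hE0 : μ E'ᶜ = 0 := by rw [hE', compl_compl, measure_toMeasurable, hE]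
    calc μ (F ∩ ⋂ j, A j (n₃ j))ᶜ ≤ _ := measure_mono hsub
      _ ≤ ((μ E'ᶜ + μ F₁ᶜ + μ F₂ᶜ) + μ ((E' ∩ (F₁ ∩ F₂)) \ F)) + μ (⋂ j, (A j (n₃ j) ∪ Fᶜ))ᶜ := by
        refine (measure_union_le _ _).trans (add_le_add_left ?_ _)
        refine (measure_union_le _ _).trans (add_le_add_left ?_ _)
        refine (measure_union_le _ _).trans (add_le_add_left ?_ _)
        exact measure_union_le _ _
      _ ≤ ((0 + η / 4 + η / 4) + η / 4) + η / 4 := by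
        rw [hE0]
        gcongr
      _ = η := by
        rw [zero_add]
        have : η / 4 + η / 4 = η / 2 := by
          rw [← two_mul, ← mul_div_assoc, show (4 : ℝ≥0∞) = 2 * 2 by norm_num,
            ENNReal.mul_div_mul_left _ _ two_ne_zero ENNReal.ofNat_ne_top]
        rw [add_assoc, this, ENNReal.add_halves]

/-! ### Projections of sets that are flat at small scales -/

section Projection

variable {Y : Type*} [NormedAddCommGroup Y] [InnerProductSpace ℝ Y]
  [MeasurableSpace Y] [BorelSpace Y] {ν : Measure Y} [IsFiniteMeasure ν] {m : ℕ}

/-- A Vitali covering estimate: a subset of an `m`-plane `V` covered by discs over which `ν` has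
large mass has small `m`-dimensional Hausdorff measure. -/
theorem hausdorffMeasure_le_of_forall_exists_disc [SecondCountableTopology Y] {V : Submodule ℝ Y}
    {C κ L R : ℝ} (hC : 0 ≤ C) (hκ : 0 < κ) (hL : 1 ≤ L)
    (hV : ∀ p ∈ V, ∀ R : ℝ, 0 ≤ R →
      μH[(m : ℝ)] ((V : Set Y) ∩ Metric.closedBall p R) ≤ ENNReal.ofReal (C * R ^ m))
    {f : Y → Y} (hf : Measurable f) {S B : Set Y} (hS : MeasurableSet S) (hBV : B ⊆ V)
    (hB : ∀ y ∈ B, ∃ v ∈ V, ∃ t : ℝ, 0 < t ∧ t ≤ R ∧ ‖y - v‖ ≤ t ∧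
      κ * t ^ m ≤ ν.real (S ∩ f ⁻¹' Metric.closedBall v (L * t))) :
    μH[(m : ℝ)] B ≤ ENNReal.ofReal (C * (5 * L) ^ m / κ * ν.real S) := by
  choose! v hvV t ht htR hyv hmass using hB
  have hL0 : 0 < L := by linarith
  -- Disjoint discs of radius `L * t` have disjoint preimages, so their masses add up to at most `ν
  -- S`, while the fivefold discs cover `B`.
  obtain ⟨u, huB, hud, hucov⟩ := Vitali.exists_disjoint_subfamily_covering_enlargement_closedBall
    B v (fun y => L * t y) (L * R) (fun y hy => by have := htR y hy; gcongr) 5 (by norm_num)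
  have huc : u.Countable := hud.countable_of_nonempty_interior fun y hy => by
    have : 0 < L * t y := mul_pos hL0 (ht y (huB hy))
    exact ⟨v y, Metric.ball_subset_interior_closedBall (Metric.mem_ball_self this)⟩
  have hcov : B ⊆ ⋃ b ∈ u, (V : Set Y) ∩ Metric.closedBall (v b) (5 * (L * t b)) := by
    intro y hy
    obtain ⟨b, hb, hsub⟩ := hucov y hy
    refine Set.mem_iUnion₂.2 ⟨b, hb, hBV hy, hsub ?_⟩
    rw [mem_closedBall_iff_norm]
    refine (hyv y hy).trans ?_
    have := ht y hy
    nlinarith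
  have : Countable u := huc.to_subtype
  calc μH[(m : ℝ)] B
      ≤ ∑' b : u, μH[(m : ℝ)] ((V : Set Y) ∩ Metric.closedBall (v b) (5 * (L * t b))) :=
        (measure_mono hcov).trans (measure_biUnion_le _ huc _)
    _ ≤ ∑' b : u, ENNReal.ofReal (C * (5 * L) ^ m / κ) *
          ν (S ∩ f ⁻¹' Metric.closedBall (v b) (L * t b)) := by
        refine ENNReal.tsum_le_tsum fun b => ?_
        have hb := huB b.2
        have htb := ht _ hb
        refine (hV _ (hvV _ hb) _ (by positivity)).trans ?_
        rw [← ofReal_measureReal (μ := ν), ← ENNReal.ofReal_mul (by positivity)]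
        refine ENNReal.ofReal_le_ofReal ?_
        calc C * (5 * (L * t b)) ^ m = C * (5 * L) ^ m / κ * (κ * t b ^ m) := by
              rw [← mul_assoc 5, mul_pow]; field_simp
          _ ≤ _ := by gcongr; exact hmass _ hb
    _ = ENNReal.ofReal (C * (5 * L) ^ m / κ) *
          ν (⋃ b ∈ u, S ∩ f ⁻¹' Metric.closedBall (v b) (L * t b)) := by
        rw [ENNReal.tsum_mul_left, measure_biUnion huc]
        · intro b hb b' hb' hne
          exact ((hud hb hb' hne).preimage f).mono Set.inter_subset_right Set.inter_subset_right
        · exact fun b _ => hS.inter (hf Metric.isClosed_closedBall.measurableSet)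
    _ ≤ ENNReal.ofReal (C * (5 * L) ^ m / κ) * ν S := by
        gcongr
        exact Set.iUnion₂_subset fun b _ => Set.inter_subset_left
    _ = _ := by
        rw [ENNReal.ofReal_mul (by positivity), ofReal_measureReal]

/-- Near a steep chord of a flat set, the mass over a small disc is large. -/
theorem mul_le_measureReal_of_steep_chord {P : Y →L[ℝ] Y} (hP : ∀ z, ‖P z‖ ≤ ‖z‖) {A : Set Y}
    {W : Submodule ℝ Y} {N : ℕ} (hN : 1 ≤ N) {s h c ε : ℝ} (hs : s * (2 * N) = 1) (hh : 0 < h)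
    (hε : ε * 8 ≤ s) {x b : Y} (hb : ‖b - x‖ = h) (hPb : ‖P (b - x)‖ ≤ s * h)
    (hbW : ∃ w ∈ W, ‖b - x - w‖ ≤ ε * (2 * h))
    (hW : ∀ w ∈ W, ‖w‖ ≤ 2 * h → ∃ q ∈ A, ‖q - x - w‖ ≤ ε * (2 * h))
    (hc : ∀ q ∈ A, c * (s * h / 4) ^ m ≤ ν.real (Metric.ball q (s * h / 4))) :
    N * (c * (s * h / 4) ^ m) ≤
      ν.real (Metric.ball x (4 * h) ∩ {p | ‖P (p - x)‖ ≤ 3 * (s * h)}) := by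
  have hN' : (1 : ℝ) ≤ N := by exact_mod_cast hN
  have hs0 : 0 < s := by
    by_contra! hneg
    nlinarith
  have hs1 : s ≤ 1 / 2 := by nlinarith
  have hsh : 0 < s * h := by positivity
  have hεh : ε * (2 * h) ≤ s * h / 4 := by nlinarith
  obtain ⟨u, huW, hu⟩ := hbW
  replace hu := hu.trans hεh
  have hu1 : h / 2 ≤ ‖u‖ := by
    have := norm_sub_norm_le (b - x) u
    nlinarith
  have hu2 : ‖u‖ ≤ 2 * h := by
    have := norm_le_norm_add_norm_sub (b - x) u
    nlinarith
  have hPu : ‖P u‖ ≤ 2 * (s * h) := by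
    have h1 := hP (b - x - u)
    rw [map_sub] at h1
    have := norm_le_norm_add_norm_sub (P (b - x)) (P u)
    nlinarith
  -- These `N` points along the chord are at least `‖u‖ / N ≥ h / (2N) = s * h` apart, so nearby
  -- points of `A` carry disjoint balls of radius `s * h / 4`, all projecting into one disc.
  let τ : Fin N → ℝ := fun j => (j : ℕ) / N
  have hτ0 : ∀ j, 0 ≤ τ j := fun j => by positivity
  have hτ1 : ∀ j, τ j ≤ 1 := fun j => by
    rw [div_le_one (by positivity)]; exact_mod_cast j.2.le
  have hq : ∀ j, ∃ q ∈ A, ‖q - x - τ j • u‖ ≤ s * h / 4 := fun j => by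
    obtain ⟨q, hqA, hq⟩ := hW (τ j • u) (W.smul_mem _ huW) (by
      rw [norm_smul, Real.norm_of_nonneg (hτ0 j)]
      nlinarith [hτ0 j, hτ1 j, norm_nonneg u])
    exact ⟨q, hqA, hq.trans hεh⟩
  choose q hqA hq using hq
  have hdisj : Pairwise fun i j => Disjoint (Metric.ball (q i) (s * h / 4))
      (Metric.ball (q j) (s * h / 4)) := by
    intro i j hij
    refine Metric.ball_disjoint_ball ?_
    have h1 : (1 : ℝ) ≤ |((i : ℕ) : ℝ) - ((j : ℕ) : ℝ)| := by
      have : (1 : ℤ) ≤ |((i : ℕ) : ℤ) - ((j : ℕ) : ℤ)| :=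
        Int.one_le_abs (sub_ne_zero.2 fun h => hij (Fin.ext (by exact_mod_cast h)))
      exact_mod_cast this
    have h2 : s * h ≤ ‖τ i • u - τ j • u‖ := by
      rw [← sub_smul, norm_smul, Real.norm_eq_abs, ← sub_div, abs_div, abs_of_pos (show (0 : ℝ) < N by
        positivity), div_mul_eq_mul_div, le_div_iff₀ (by positivity)]
      nlinarith [norm_nonneg u]
    have h3 : ‖τ i • u - τ j • u‖ ≤ ‖q i - q j‖ + s * h / 4 + s * h / 4 := by
      have e : τ i • u - τ j • u = (q i - q j) - (q i - x - τ i • u) + (q j - x - τ j • u) := by abel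
      rw [e]
      refine (norm_add_le _ _).trans (add_le_add ((norm_sub_le _ _).trans ?_) (hq j))
      gcongr
      exact hq i
    rw [dist_eq_norm]
    linarith
  have hsub : (⋃ j, Metric.ball (q j) (s * h / 4)) ⊆
      Metric.ball x (4 * h) ∩ {p | ‖P (p - x)‖ ≤ 3 * (s * h)} := by
    refine Set.iUnion_subset fun j p hp => ?_
    rw [mem_ball_iff_norm] at hp
    have e : p - x = (p - q j) + (q j - x - τ j • u) + τ j • u := by abel
    have h1 : ‖(p - q j) + (q j - x - τ j • u)‖ ≤ s * h / 4 + s * h / 4 :=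
      (norm_add_le _ _).trans (add_le_add hp.le (hq j))
    constructor
    · rw [mem_ball_iff_norm, e]
      have h2 : ‖τ j • u‖ ≤ 2 * h := by
        rw [norm_smul, Real.norm_of_nonneg (hτ0 j)]
        nlinarith [hτ0 j, hτ1 j, norm_nonneg u]
      have := norm_add_le ((p - q j) + (q j - x - τ j • u)) (τ j • u)
      nlinarith
    · change ‖P (p - x)‖ ≤ 3 * (s * h)
      rw [e, map_add]
      have h2 : ‖P (τ j • u)‖ ≤ 2 * (s * h) := by
        rw [map_smul, norm_smul, Real.norm_of_nonneg (hτ0 j)]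
        nlinarith [hτ0 j, hτ1 j, norm_nonneg (P u)]
      have h3 := norm_add_le (P ((p - q j) + (q j - x - τ j • u))) (P (τ j • u))
      have h4 := hP ((p - q j) + (q j - x - τ j • u))
      linarith
  refine le_trans ?_ (measureReal_mono hsub)
  rw [measureReal_iUnion_fintype hdisj fun j => Metric.isOpen_ball.measurableSet]
  calc (N : ℝ) * (c * (s * h / 4) ^ m) = ∑ _j : Fin N, c * (s * h / 4) ^ m := by simp
    _ ≤ _ := Finset.sum_le_sum fun j _ => hc _ (hqA j)

omit [BorelSpace Y] in
/-- At the boundary of a hole in the projection of `K`, in the absence of steep chords, the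
complement of `K` carries a definite amount of mass. -/
theorem mul_le_measureReal_diff_of_hole {V W : Submodule ℝ Y}
    [FiniteDimensional ℝ V] [FiniteDimensional ℝ W] (hVW : Module.finrank ℝ W = Module.finrank ℝ V)
    {A K : Set Y} {s ρ c : ℝ} (hs : 0 < s) (hs1 : s ≤ 1) (hρ : 0 < ρ) {x y : Y} (hyV : y ∈ V)
    (hy : ‖y‖ ≤ ρ)
    (hole : ∀ k ∈ K, ‖k - x‖ < 8 * ρ / s → ρ ≤ ‖V.starProjection (k - x) - y‖)
    (hsteep : ∀ k ∈ K, ‖k - x‖ < 8 * ρ / s → ‖V.starProjection (k - x)‖ ≤ s * ‖k - x‖ →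
      s * ‖k - x‖ < ρ)
    (hW : ∀ w ∈ W, ‖w‖ ≤ 4 * ρ / s → ∃ q ∈ A, ‖q - x - w‖ ≤ s / 16 * (4 * ρ / s))
    (hc : ∀ q ∈ A, c * (ρ / 4) ^ m ≤ ν.real (Metric.ball q (ρ / 4))) :
    c * (ρ / 4) ^ m ≤ ν.real (Metric.ball x (8 * ρ / s) \ K) := by
  set R := 4 * ρ / s with hR
  have hRpos : 0 < R := by positivity
  have hsR : s * R = 4 * ρ := by rw [hR]; field_simp
  have h2R : 8 * ρ / s = 2 * R := by rw [hR]; ring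
  have hρR : 4 * ρ ≤ R := by rw [← hsR]; nlinarith
  rw [h2R] at hole hsteep ⊢
  have he : s / 16 * R = ρ / 4 := by linarith
  rw [he] at hW
  have hP := fun z => V.norm_starProjection_apply_le z
  suffices h : ∃ q ∈ A, ‖q - x‖ ≤ R ∧ ∀ k ∈ K, ‖k - q‖ < ρ / 4 → False by
    obtain ⟨q, hqA, hqx, hq⟩ := h
    refine (hc q hqA).trans (measureReal_mono fun p hp => ?_)
    rw [mem_ball_iff_norm] at hp
    refine ⟨?_, fun hpK => hq p hpK hp⟩
    rw [mem_ball_iff_norm]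
    have := norm_sub_le_norm_sub_add_norm_sub p q x
    linarith
  -- Either `W` has a direction steep over `V`, or `W` projects onto `V` with inverse bounded by `2
  -- / s`. In both cases some `q ∈ A` has no point of `K` within `ρ / 4`: such a point would end a
  -- forbidden steep chord, respectively project into the hole.
  by_cases hsub : ∃ w ∈ W, ‖V.starProjection w‖ < s / 2 * ‖w‖
  · obtain ⟨w₀, hw₀W, hw₀⟩ := hsub
    have hw₀0 : 0 < ‖w₀‖ := by
      by_contra! hneg
      have h0 : ‖w₀‖ = 0 := le_antisymm hneg (norm_nonneg _)
      rw [h0, mul_zero] at hw₀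
      exact absurd hw₀ (norm_nonneg _).not_gt
    -- At length `R / 2` the projection of `w` has norm at most `s * R / 4 = ρ`.
    set w := (R / 2 / ‖w₀‖) • w₀ with hw
    have hwn : ‖w‖ = R / 2 := by
      rw [hw, norm_smul, Real.norm_of_nonneg (by positivity)]; field_simp
    have hPw : ‖V.starProjection w‖ ≤ ρ := by
      rw [hw, map_smul, norm_smul, Real.norm_of_nonneg (by positivity)]
      calc R / 2 / ‖w₀‖ * ‖V.starProjection w₀‖ ≤ R / 2 / ‖w₀‖ * (s / 2 * ‖w₀‖) := by gcongr
        _ = s * R / 4 := by field_simp; ring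
        _ = ρ := by rw [hsR]; ring
    obtain ⟨q, hqA, hq⟩ := hW w (W.smul_mem _ hw₀W) (by rw [hwn]; linarith)
    have hqx : ‖q - x‖ ≤ ρ / 4 + R / 2 := by
      have e : q - x = (q - x - w) + w := by abel
      rw [e]
      exact (norm_add_le _ _).trans (add_le_add hq hwn.le)
    refine ⟨q, hqA, by linarith, fun k hk hkq => ?_⟩
    have e : k - x = w + ((k - q) + (q - x - w)) := by abel
    have hz : ‖(k - q) + (q - x - w)‖ ≤ ρ / 4 + ρ / 4 :=
      (norm_add_le _ _).trans (add_le_add hkq.le hq)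
    have h1 : ‖k - x‖ ≤ R / 2 + ρ / 2 := by
      rw [e]; have := norm_add_le w ((k - q) + (q - x - w)); linarith
    have h2 : R / 2 - ρ / 2 ≤ ‖k - x‖ := by
      have := norm_sub_norm_le w (-((k - q) + (q - x - w)))
      rw [sub_neg_eq_add, ← e, norm_neg] at this
      linarith
    have h3 : ‖V.starProjection (k - x)‖ ≤ ρ + ρ / 2 := by
      rw [e, map_add]
      have h4 := norm_add_le (V.starProjection w) (V.starProjection ((k - q) + (q - x - w)))
      have h5 := hP ((k - q) + (q - x - w))
      linarith
    have h6 : ρ + ρ / 2 ≤ s * ‖k - x‖ := by nlinarith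
    have := hsteep k hk (by linarith) (h3.trans h6)
    linarith
  · push Not at hsub
    let T : W →ₗ[ℝ] V := (V.orthogonalProjectionOnto : Y →ₗ[ℝ] V) ∘ₗ W.subtype
    have hT : ∀ w : W, ((T w : V) : Y) = V.starProjection (w : Y) := fun w => rfl
    have hinj : Function.Injective T := by
      rw [← LinearMap.ker_eq_bot, LinearMap.ker_eq_bot']
      intro w hw
      have h1 := hsub w w.2
      rw [← hT, hw, ZeroMemClass.coe_zero, norm_zero] at h1
      have h2 : ‖(w : Y)‖ ≤ 0 := by
        by_contra! hpos
        have : 0 < s / 2 * ‖(w : Y)‖ := by positivity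
        linarith
      exact Subtype.ext (norm_le_zero_iff.1 h2)
    obtain ⟨w, hw⟩ := (LinearMap.injective_iff_surjective_of_finrank_eq_finrank hVW).1 hinj ⟨y, hyV⟩
    have hPw : V.starProjection (w : Y) = y := by rw [← hT, hw]
    have hwn : ‖(w : Y)‖ ≤ R / 2 := by
      have h1 := hsub w w.2
      rw [hPw] at h1
      by_contra! hcon
      nlinarith
    obtain ⟨q, hqA, hq⟩ := hW w w.2 (by linarith)
    have hqx : ‖q - x‖ ≤ ρ / 4 + R / 2 := by
      have e : q - x = (q - x - w) + w := by abel
      rw [e]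
      exact (norm_add_le _ _).trans (add_le_add hq hwn)
    refine ⟨q, hqA, by linarith, fun k hk hkq => ?_⟩
    have e : k - x = w + ((k - q) + (q - x - w)) := by abel
    have hz : ‖(k - q) + (q - x - w)‖ ≤ ρ / 4 + ρ / 4 :=
      (norm_add_le _ _).trans (add_le_add hkq.le hq)
    have h1 : ‖k - x‖ ≤ R / 2 + ρ / 2 := by
      rw [e]; have := norm_add_le (w : Y) ((k - q) + (q - x - w)); linarith
    have h2 := hole k hk (by linarith)
    rw [e, map_add, hPw, add_sub_cancel_left] at h2
    have h5 := hP ((k - q) + (q - x - w))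
    linarith

end Projection

section Projection

variable {Y : Type*} [NormedAddCommGroup Y] [InnerProductSpace ℝ Y] [FiniteDimensional ℝ Y]
  [MeasurableSpace Y] [BorelSpace Y] {ν : Measure Y} [IsFiniteMeasure ν] {m : ℕ}

set_option maxHeartbeats 400000 in
/-- A point `y` of the plane `V` that is missed by the projection of `K` near `a` either lies in a
disc over which there is a lot of mass, or in a disc over which the complement of `K` has mass. -/
theorem exists_disc_of_notMem_projection {A K : Set Y} (hK : IsCompact K) (hKA : K ⊆ A)
    {V : Submodule ℝ Y} (hV : Module.finrank ℝ V = m) {N : ℕ} (hN : 1 ≤ N)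
    {s θ ε c r : ℝ} (hs : s * (2 * N) = 1) (hθ : 0 < θ) (hθ1 : θ < 1) (hε : 0 < ε)
    (hεs : 20 * ε ≤ s * θ) (hr : 0 < r) {a : Y}
    (hlow : ∀ q ∈ A, ∀ t : ℝ, 0 < t → t ≤ r → c * t ^ m ≤ ν.real (Metric.ball q t))
    (hVA : ∀ y ∈ A, ‖y - a‖ ≤ r → ∃ w ∈ V, ‖y - a - w‖ ≤ ε * r)
    (hAV : ∀ w ∈ V, ‖w‖ ≤ r → ∃ q ∈ A, ‖q - a - w‖ ≤ ε * r)
    (hflat : ∀ x ∈ K, ∀ t : ℝ, 0 < t → t ≤ r → ∃ W : Submodule ℝ Y,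
      Module.finrank ℝ W = m ∧ (∀ y ∈ A, ‖y - x‖ ≤ t → ∃ w ∈ W, ‖y - x - w‖ ≤ s / 16 * t) ∧
      ∀ w ∈ W, ‖w‖ ≤ t → ∃ q ∈ A, ‖q - x - w‖ ≤ s / 16 * t)
    (hKa : ν.real (Metric.ball a r \ K) < c * (ε * r) ^ m) {y : Y} (hyV : y ∈ V)
    (hyr : ‖y‖ ≤ (1 - 2 * θ) * r)
    (hy : y ∉ (fun p => V.starProjection (p - a)) '' (K ∩ Metric.ball a r)) :
    (∃ v ∈ V, ∃ t : ℝ, 0 < t ∧ t ≤ r ∧ ‖y - v‖ ≤ t ∧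
      N * c / 4 ^ m * t ^ m ≤ ν.real (Metric.ball a r ∩
        (fun p => V.starProjection (p - a)) ⁻¹' Metric.closedBall v (3 * t))) ∨
    ∃ v ∈ V, ∃ t : ℝ, 0 < t ∧ t ≤ r ∧ ‖y - v‖ ≤ t ∧
      c / 4 ^ m * t ^ m ≤ ν.real ((Metric.ball a r \ K) ∩
        (fun p => V.starProjection (p - a)) ⁻¹' Metric.closedBall v (8 / s * t)) := by
  have hN' : (1 : ℝ) ≤ N := by exact_mod_cast hN
  have hs0 : 0 < s := by
    by_contra! hneg
    nlinarith
  have hs1 : s ≤ 1 / 2 := by nlinarith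
  set P := V.starProjection with hPdef
  have hP : ∀ z, ‖P z‖ ≤ ‖z‖ := fun z => V.norm_starProjection_apply_le z
  have hPmem : ∀ z, P z ∈ V := fun z => V.starProjection_apply_mem z
  have hPy : P y = y := V.starProjection_eq_self_iff.2 hyV
  set f : Y → Y := fun p => P (p - a) with hf
  have hεr : 0 < ε * r := by positivity
  have hθr : 0 < θ * r := by positivity
  have hθr1 : θ * r < r := by nlinarith
  have hεrs : 20 * (ε * r) ≤ s * (θ * r) := by nlinarith
  have hsθr : s * (θ * r) ≤ s * r := mul_le_mul_of_nonneg_left hθr1.le hs0.le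
  have hsθr' : s * (θ * r) ≤ 1 / 2 * (θ * r) := mul_le_mul_of_nonneg_right hs1 hθr.le
  have hεrθ : 40 * (ε * r) ≤ θ * r := by linarith
  have hPdist : ∀ z ∈ A, ‖z - a‖ ≤ r → ‖(z - a) - P (z - a)‖ ≤ ε * r := by
    intro z hz hzr
    obtain ⟨w, hw, hzw⟩ := hVA z hz hzr
    rw [hPdef, V.starProjection_minimal]
    exact (ciInf_le ⟨0, by rintro _ ⟨w, rfl⟩; positivity⟩ (⟨w, hw⟩ : V)).trans hzw
  -- A compact piece of `K`, so that a point projecting nearest to `y` exists; the margin `θ * r`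
  -- keeps later constructions inside the ball.
  set G := K ∩ Metric.closedBall a ((1 - θ) * r) with hG
  have hGc : IsCompact G := hK.inter_right Metric.isClosed_closedBall
  have hGball : ∀ k ∈ K, ‖k - a‖ ≤ (1 - θ) * r → k ∈ G := fun k hk hka =>
    ⟨hk, mem_closedBall_iff_norm.2 hka⟩
  have hGr : ∀ k ∈ G, ‖k - a‖ < r := fun k hk => by
    have := mem_closedBall_iff_norm.1 hk.2
    linarith
  -- the projection of `G` comes close to `y`
  obtain ⟨k₀, hk₀G, hk₀⟩ : ∃ k ∈ G, ‖f k - y‖ ≤ 2 * (ε * r) := by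
    obtain ⟨q, hqA, hq⟩ := hAV y hyV (by linarith)
    have hsub : Metric.ball q (ε * r) ⊆ Metric.ball a r := by
      refine Metric.ball_subset_ball' ?_
      rw [dist_eq_norm]
      have e : q - a = y + (q - a - y) := by abel
      have h2 := norm_add_le y (q - a - y)
      rw [← e] at h2
      linarith
    obtain ⟨k, hk, hkK⟩ : ∃ k ∈ Metric.ball q (ε * r), k ∈ K := by
      by_contra! hcon
      have h1 : ν.real (Metric.ball q (ε * r)) ≤ ν.real (Metric.ball a r \ K) :=
        measureReal_mono fun p hp => ⟨hsub hp, hcon p hp⟩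
      have h2 := hlow q hqA (ε * r) hεr (by linarith)
      linarith
    rw [mem_ball_iff_norm] at hk
    have e : k - a - y = (k - q) + (q - a - y) := by abel
    have h1 : ‖k - a - y‖ ≤ 2 * (ε * r) := by
      rw [e]; have := norm_add_le (k - q) (q - a - y); linarith
    refine ⟨k, hGball k hkK ?_, ?_⟩
    · have e : k - a = y + (k - a - y) := by abel
      rw [e]
      have := norm_add_le y (k - a - y)
      linarith
    · have e2 : f k - y = P (k - a - y) := by rw [map_sub, hPy]
      rw [e2]
      exact (hP _).trans h1
  have hfcont : Continuous f := by fun_prop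
  obtain ⟨x, hxG, hxmin⟩ := hGc.exists_isMinOn ⟨k₀, hk₀G⟩ (f := fun k => ‖f k - y‖)
    (by fun_prop)
  set ρ := ‖f x - y‖ with hρdef
  have hρmin : ∀ k ∈ G, ρ ≤ ‖f k - y‖ := fun k hk => hxmin hk
  have hρ : 0 < ρ := by
    rw [hρdef, norm_pos_iff, sub_ne_zero]
    exact fun h => hy ⟨x, ⟨hxG.1, mem_ball_iff_norm.2 (hGr x hxG)⟩, h⟩
  have hρr : ρ ≤ 2 * (ε * r) := (hρmin k₀ hk₀G).trans hk₀
  have hxA : x ∈ A := hKA hxG.1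
  have hxa : ‖x - a‖ ≤ (1 - 2 * θ) * r + 3 * (ε * r) := by
    have e : x - a = y + (f x - y) + ((x - a) - P (x - a)) := by simp only [hf]; abel
    rw [e]
    have h1 := norm_add_le (y + (f x - y)) ((x - a) - P (x - a))
    have h2 := norm_add_le y (f x - y)
    have h3 := hPdist x hxA (hGr x hxG).le
    linarith
  -- By `20 * ε ≤ s * θ`, points of `K` this close to `x` lie in `G`, where the extremal choices of
  -- `x` and `b` apply.
  have hnear : ∀ p, ‖p - x‖ < 16 * (ε * r) / s → ‖p - a‖ ≤ (1 - θ) * r := by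
    intro p hp
    have e : p - a = (p - x) + (x - a) := by abel
    have h1 : 16 * (ε * r) / s ≤ 16 / 20 * θ * r := by
      rw [div_le_iff₀ hs0]
      linarith
    rw [e]
    have := norm_add_le (p - x) (x - a)
    linarith
  have hnear' : ∀ p, ‖p - x‖ < 16 * (ε * r) / s → p ∈ Metric.ball a r := fun p hp => by
    rw [mem_ball_iff_norm]
    have := hnear p hp
    linarith
  have hPsub : ∀ p, P (p - x) = f p - f x := fun p => by
    simp only [hf]
    rw [← map_sub, sub_sub_sub_cancel_right]
  -- the longest steep chord at `x`
  have hcone : IsCompact (G ∩ {b | ‖P (b - x)‖ ≤ s * ‖b - x‖}) :=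
    hGc.inter_right (isClosed_le (by fun_prop) (by fun_prop))
  obtain ⟨b, ⟨hbG, hbs⟩, hbmax⟩ := hcone.exists_isMaxOn ⟨x, hxG, by simp⟩
    (f := fun b => ‖b - x‖) (by fun_prop)
  have hbs : ‖P (b - x)‖ ≤ s * ‖b - x‖ := hbs
  have hhmax : ∀ k ∈ G, ‖P (k - x)‖ ≤ s * ‖k - x‖ → ‖k - x‖ ≤ ‖b - x‖ := fun k hk hks =>
    hbmax ⟨hk, hks⟩
  set h := ‖b - x‖ with hh
  have hhr : h ≤ 4 * (ε * r) := by
    have e : b - x = P (b - x) + (((b - a) - P (b - a)) - ((x - a) - P (x - a))) := by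
      rw [hPsub]; simp only [hf]; abel
    have h1 := hPdist b (hKA hbG.1) (hGr b hbG).le
    have h2 := hPdist x hxA (hGr x hxG).le
    have h3 : h ≤ ‖P (b - x)‖ + (‖(b - a) - P (b - a)‖ + ‖(x - a) - P (x - a)‖) := by
      rw [hh]
      conv_lhs => rw [e]
      exact (norm_add_le _ _).trans (by gcongr; exact norm_sub_le _ _)
    have h4 : s * h ≤ 1 / 2 * h := mul_le_mul_of_nonneg_right hs1 (norm_nonneg _)
    linarith
  -- The disc about `f x` has as radius the larger of `s * h` (excess mass along the chord) and `ρ`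
  -- (a hole of `K`).
  rcases le_or_gt ρ (s * h) with hcase | hcase
  · left
    have hhpos : 0 < h := by
      by_contra! hneg
      have := mul_nonpos_of_nonneg_of_nonpos hs0.le hneg
      linarith
    have hshpos : 0 < s * h := by positivity
    have hsh : s * h ≤ 1 / 2 * h := mul_le_mul_of_nonneg_right hs1 hhpos.le
    obtain ⟨W, -, hW1, hW2⟩ := hflat x hxG.1 (2 * h) (by positivity) (by linarith)
    have hmass := mul_le_measureReal_of_steep_chord (ν := ν) (m := m) hP hN hs hhpos (ε := s / 16)
      (by linarith) hh.symm hbs (hW1 b (hKA hbG.1) (by linarith)) hW2 (c := c)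
      (fun q hq => hlow q hq _ (by positivity) (by linarith))
    refine ⟨f x, hPmem _, s * h, hshpos, by linarith, ?_, ?_⟩
    · rw [norm_sub_rev]; exact hcase
    · calc N * c / 4 ^ m * (s * h) ^ m = N * (c * (s * h / 4) ^ m) := by rw [div_pow]; ring
        _ ≤ _ := hmass
        _ ≤ _ := by
          refine measureReal_mono fun p hp => ⟨hnear' p ?_, ?_⟩
          · have h1 := mem_ball_iff_norm.1 hp.1
            rw [lt_div_iff₀ hs0]
            have h2 : ‖p - x‖ * s ≤ ‖p - x‖ * 1 :=
              mul_le_mul_of_nonneg_left (hs1.trans (by norm_num)) (norm_nonneg _)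
            linarith
          · rw [Set.mem_preimage, mem_closedBall_iff_norm, ← hPsub]
            exact hp.2
  · right
    have h8 : 8 * ρ / s ≤ 16 * (ε * r) / s := div_le_div_of_nonneg_right (by linarith) hs0.le
    have h4r : 4 * ρ / s ≤ r := by
      rw [div_le_iff₀ hs0]
      linarith
    obtain ⟨W, hWm, -, hW2⟩ := hflat x hxG.1 (4 * ρ / s) (by positivity) h4r
    have hkG : ∀ k ∈ K, ‖k - x‖ < 8 * ρ / s → k ∈ G := fun k hk hkx =>
      hGball k hk (hnear k (hkx.trans_le h8))
    have hhole : ∀ k ∈ K, ‖k - x‖ < 8 * ρ / s → ρ ≤ ‖P (k - x) - (y - f x)‖ := by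
      intro k hk hkx
      rw [hPsub, sub_sub_sub_cancel_right]
      exact hρmin k (hkG k hk hkx)
    have hsteep : ∀ k ∈ K, ‖k - x‖ < 8 * ρ / s → ‖P (k - x)‖ ≤ s * ‖k - x‖ →
        s * ‖k - x‖ < ρ := by
      intro k hk hkx hks
      exact (mul_le_mul_of_nonneg_left (hhmax k (hkG k hk hkx) hks) hs0.le).trans_lt hcase
    have hyx : ‖y - f x‖ ≤ ρ := by rw [norm_sub_rev]
    have hρ4 : ρ / 4 ≤ r := by linarith
    have hmass := mul_le_measureReal_diff_of_hole (ν := ν) (m := m)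
      (hWm.trans hV.symm) hs0 (hs1.trans (by norm_num)) hρ (V.sub_mem hyV (hPmem (x - a))) hyx
      hhole hsteep hW2 (fun q hq => hlow q hq (ρ / 4) (by positivity) hρ4)
    refine ⟨f x, hPmem _, ρ, hρ, by linarith, ?_, ?_⟩
    · rw [norm_sub_rev]
    · calc c / 4 ^ m * ρ ^ m = c * (ρ / 4) ^ m := by rw [div_pow]; ring
        _ ≤ _ := hmass
        _ ≤ _ := by
          refine measureReal_mono fun p hp => ?_
          have h1 := mem_ball_iff_norm.1 hp.1
          refine ⟨⟨hnear' p (h1.trans_le h8), hp.2⟩, ?_⟩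
          rw [Set.mem_preimage, mem_closedBall_iff_norm, ← hPsub, div_mul_eq_mul_div]
          exact (hP _).trans h1.le

/-- Near a density point `a` of `K`, the set `K` has almost full projection to some `m`-plane. -/
theorem exists_submodule_le_hausdorffMeasure_projection {A K : Set Y} (hK : IsCompact K)
    (hKA : K ⊆ A) {c C r₁ : ℝ} (hc : 0 < c) (hC : 0 < C) (hr₁ : 0 < r₁)
    (hlow : ∀ q ∈ A, ∀ t : ℝ, 0 < t → t < r₁ → c * t ^ m ≤ ν.real (Metric.ball q t))
    (hup : ∀ q ∈ A, ∀ t : ℝ, 0 < t → t < r₁ → ν.real (Metric.ball q t) ≤ C * t ^ m)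
    (hflat : IsFlatAt m A K) {a : Y} (ha : a ∈ K)
    (hdens : ∀ δ > 0, ∃ r₀ > 0, ∀ r : ℝ, 0 < r → r < r₀ →
      ν.real (Metric.ball a r \ K) ≤ δ * r ^ m) {η : ℝ} (hη : 0 < η) (hη1 : η < 1 / 2) :
    ∃ r₀ > 0, ∀ r : ℝ, 0 < r → r < r₀ → ∃ V : Submodule ℝ Y, Module.finrank ℝ V = m ∧
      ENNReal.ofReal (2 * ((1 - 2 * η) * r)) ^ m ≤
        μH[(m : ℝ)] ((fun p => V.starProjection (p - a)) '' (K ∩ Metric.ball a r)) +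
          ENNReal.ofReal (η * r ^ m) := by
  obtain ⟨C', hC', hdisc⟩ := hausdorffMeasure_inter_closedBall_le Y m
  -- `N` is so large that the steep-chord discs cover at most `η / 2 * r ^ m`.
  obtain ⟨N, hN⟩ := exists_nat_gt (max 1 (C' * (5 * 3) ^ m * 4 ^ m * C * 2 / (c * η)))
  rw [max_lt_iff] at hN
  have hN1 : 1 ≤ N := by exact_mod_cast hN.1.le
  have hN0 : (0 : ℝ) < N := by linarith [hN.1]
  set s : ℝ := 1 / (2 * N) with hs
  have hs0 : 0 < s := by positivity
  have hsN : s * (2 * N) = 1 := by rw [hs]; field_simp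
  set ε : ℝ := s * η / 20 with hεdef
  have hε : 0 < ε := by positivity
  have hs1 : s ≤ 1 := by
    rw [hs, div_le_one (by positivity)]; linarith [hN.1]
  set L : ℝ := 8 / s with hL
  have hL1 : 1 ≤ L := by rw [hL, one_le_div hs0]; linarith
  -- Chosen after `s`: the first term makes `K` meet every ball of radius `ε * r` used near `a`, the
  -- second keeps the measure of the hole discs below `η / 2 * r ^ m`.
  set δ : ℝ := min (c * ε ^ m / 2) (η * c / (2 * (C' * (5 * L) ^ m * 4 ^ m))) with hδdef
  have hδ : 0 < δ := by positivity
  obtain ⟨r₂, hr₂, hflat₂⟩ := hflat ε hε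
  obtain ⟨r₃, hr₃, hflat₃⟩ := hflat (s / 16) (by positivity)
  obtain ⟨r₄, hr₄, hdens₄⟩ := hdens δ hδ
  refine ⟨min (min r₁ r₂) (min r₃ r₄), lt_min (lt_min hr₁ hr₂) (lt_min hr₃ hr₄), fun r hr hrr => ?_⟩
  simp only [lt_min_iff] at hrr
  obtain ⟨⟨hrr₁, hrr₂⟩, hrr₃, hrr₄⟩ := hrr
  obtain ⟨V, hVm, hVA, hAV⟩ := hflat₂ a ha r hr hrr₂
  refine ⟨V, hVm, ?_⟩
  set f : Y → Y := fun p => V.starProjection (p - a) with hf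
  have hfm : Measurable f := by
    have : Continuous f := by fun_prop
    exact this.measurable
  have hdens' := hdens₄ r hr hrr₄
  have hrm : 0 < r ^ m := by positivity
  have hKa : ν.real (Metric.ball a r \ K) < c * (ε * r) ^ m := by
    refine hdens'.trans_lt ?_
    rw [mul_pow, ← mul_assoc]
    have h1 : δ ≤ c * ε ^ m / 2 := min_le_left _ _
    have h2 : 0 < c * ε ^ m := by positivity
    gcongr
    linarith
  have hdich := fun (y : Y) (hyV : y ∈ V) (hyr : ‖y‖ ≤ (1 - 2 * η) * r)
      (hy : y ∉ f '' (K ∩ Metric.ball a r)) =>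
    exists_disc_of_notMem_projection (ν := ν) hK hKA hVm hN1 hsN hη (by linarith) hε
      (by rw [hεdef]; linarith) hr (a := a)
      (fun q hq t ht htr => hlow q hq t ht (htr.trans_lt hrr₁)) hVA hAV
      (fun x hx t ht htr => hflat₃ x hx t ht (htr.trans_lt hrr₃)) hKa hyV hyr hy
  set B₁ : Set Y := {y | y ∈ V ∧ ∃ v ∈ V, ∃ t : ℝ, 0 < t ∧ t ≤ r ∧ ‖y - v‖ ≤ t ∧
      N * c / 4 ^ m * t ^ m ≤ ν.real (Metric.ball a r ∩ f ⁻¹' Metric.closedBall v (3 * t))} with hB₁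
  set B₂ : Set Y := {y | y ∈ V ∧ ∃ v ∈ V, ∃ t : ℝ, 0 < t ∧ t ≤ r ∧ ‖y - v‖ ≤ t ∧
      c / 4 ^ m * t ^ m ≤ ν.real ((Metric.ball a r \ K) ∩ f ⁻¹' Metric.closedBall v (L * t))} with hB₂
  have hm₁ := hausdorffMeasure_le_of_forall_exists_disc (ν := ν) (m := m) (V := V) (R := r)
    (B := B₁) hC'.le (show 0 < N * c / 4 ^ m by positivity) (show (1 : ℝ) ≤ 3 by norm_num)
    (hdisc V inferInstance hVm) hfm Metric.isOpen_ball.measurableSet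
    (fun y hy => hy.1) (fun y hy => hy.2)
  have hm₂ := hausdorffMeasure_le_of_forall_exists_disc (ν := ν) (m := m) (V := V) (R := r)
    (B := B₂) hC'.le (show 0 < c / 4 ^ m by positivity) hL1
    (hdisc V inferInstance hVm) hfm (Metric.isOpen_ball.measurableSet.diff hK.isClosed.measurableSet)
    (fun y hy => hy.1) (fun y hy => hy.2)
  have hb₁ : C' * (5 * 3) ^ m / (N * c / 4 ^ m) * ν.real (Metric.ball a r) ≤ η / 2 * r ^ m := by
    have h1 := hup a (hKA ha) r hr hrr₁
    have h2 := (div_lt_iff₀ (by positivity)).1 hN.2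
    calc C' * (5 * 3) ^ m / (N * c / 4 ^ m) * ν.real (Metric.ball a r)
        ≤ C' * (5 * 3) ^ m / (N * c / 4 ^ m) * (C * r ^ m) := by gcongr
      _ = (C' * (5 * 3) ^ m * 4 ^ m * C * 2) / (2 * (N * c)) * r ^ m := by field_simp
      _ ≤ η / 2 * r ^ m := by
        refine mul_le_mul_of_nonneg_right ?_ hrm.le
        rw [div_le_iff₀ (by positivity)]
        exact h2.le.trans (le_of_eq (by ring))
  have hb₂ : C' * (5 * L) ^ m / (c / 4 ^ m) * ν.real (Metric.ball a r \ K) ≤ η / 2 * r ^ m := by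
    have h1 : δ ≤ η * c / (2 * (C' * (5 * L) ^ m * 4 ^ m)) := min_le_right _ _
    calc C' * (5 * L) ^ m / (c / 4 ^ m) * ν.real (Metric.ball a r \ K)
        ≤ C' * (5 * L) ^ m / (c / 4 ^ m) * (η * c / (2 * (C' * (5 * L) ^ m * 4 ^ m)) * r ^ m) := by
          gcongr
          exact hdens'.trans (by gcongr)
      _ = η / 2 * r ^ m := by
          have : 0 < L := by linarith
          field_simp
  have hcov : (V : Set Y) ∩ Metric.closedBall 0 ((1 - 2 * η) * r) ⊆
      f '' (K ∩ Metric.ball a r) ∪ (B₁ ∪ B₂) := by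
    rintro y ⟨hyV, hyr⟩
    by_cases hy : y ∈ f '' (K ∩ Metric.ball a r)
    · exact Or.inl hy
    · rcases hdich y hyV (by simpa using hyr) hy with h | h
      · exact Or.inr (Or.inl ⟨hyV, h⟩)
      · exact Or.inr (Or.inr ⟨hyV, h⟩)
  calc ENNReal.ofReal (2 * ((1 - 2 * η) * r)) ^ m
      ≤ μH[(m : ℝ)] ((V : Set Y) ∩ Metric.closedBall 0 ((1 - 2 * η) * r)) :=
        ofReal_two_mul_pow_le_hausdorffMeasure V hVm (mul_nonneg (by linarith) hr.le)
    _ ≤ μH[(m : ℝ)] (f '' (K ∩ Metric.ball a r)) + (μH[(m : ℝ)] B₁ + μH[(m : ℝ)] B₂) :=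
        (measure_mono hcov).trans ((measure_union_le _ _).trans (by
          gcongr; exact measure_union_le _ _))
    _ ≤ μH[(m : ℝ)] (f '' (K ∩ Metric.ball a r)) +
        (ENNReal.ofReal (η / 2 * r ^ m) + ENNReal.ofReal (η / 2 * r ^ m)) := by
        gcongr
        · exact hm₁.trans (ENNReal.ofReal_le_ofReal hb₁)
        · exact hm₂.trans (ENNReal.ofReal_le_ofReal hb₂)
    _ = _ := by
        rw [← ENNReal.ofReal_add (by positivity) (by positivity)]
        ring_nf

end Projection

/-! ### Regular sets -/

section Regular

variable {X : Type*} [NormedAddCommGroup X] [MeasurableSpace X] {m : ℕ} {E : Set X}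

theorem exists_lower_density_of_tendsto {μ : Measure X} [IsFiniteMeasure μ] {a : X}
    (h : Tendsto (fun r : ℝ => μ (Metric.ball a r) / ENNReal.ofReal (2 * r) ^ m) (𝓝[>] 0) (𝓝 1))
    {δ : ℝ} (hδ : 0 < δ) : ∃ r₀ > 0, ∀ r : ℝ, 0 < r → r < r₀ →
      (1 - δ) * (2 * r) ^ m ≤ μ.real (Metric.ball a r) := by
  have h1 : ENNReal.ofReal (1 - δ) < 1 := by
    rw [← ENNReal.ofReal_one, ENNReal.ofReal_lt_ofReal_iff one_pos]
    linarith
  obtain ⟨r₀, hr₀, h2⟩ := mem_nhdsGT_iff_exists_Ioo_subset.1 (h.eventually_const_lt h1)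
  refine ⟨r₀, hr₀, fun r hr hrr => ?_⟩
  have h3 : ENNReal.ofReal (1 - δ) < μ (Metric.ball a r) / ENNReal.ofReal (2 * r) ^ m := h2 ⟨hr, hrr⟩
  have h4 := ENNReal.mul_le_of_le_div h3.le
  have h5 := ENNReal.toReal_mono (measure_ne_top _ _) h4
  rw [ENNReal.toReal_mul, ENNReal.toReal_pow, ENNReal.toReal_ofReal (show (0 : ℝ) ≤ 2 * r by positivity)] at h5
  refine le_trans ?_ h5
  gcongr
  rw [ENNReal.toReal_ofReal']
  exact le_max_left _ _

theorem exists_measureReal_ball_le_of_tendsto {μ : Measure X} [IsFiniteMeasure μ] {a : X}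
    (h : Tendsto (fun r : ℝ => μ (Metric.ball a r) / ENNReal.ofReal (2 * r) ^ m) (𝓝[>] 0) (𝓝 1)) :
    ∃ r₀ > 0, ∀ r : ℝ, 0 < r → r < r₀ → μ.real (Metric.ball a r) ≤ 2 * (2 * r) ^ m := by
  obtain ⟨r₀, hr₀, h2⟩ := mem_nhdsGT_iff_exists_Ioo_subset.1
    (h.eventually_lt_const (ENNReal.one_lt_two))
  refine ⟨r₀, hr₀, fun r hr hrr => ?_⟩
  have h3 : μ (Metric.ball a r) / ENNReal.ofReal (2 * r) ^ m < 2 := h2 ⟨hr, hrr⟩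
  have h4 := (ENNReal.div_le_iff_le_mul (Or.inr ENNReal.ofNat_ne_top)
    (Or.inl (ENNReal.pow_ne_top ENNReal.ofReal_ne_top))).1 h3.le
  have h5 := ENNReal.toReal_mono
    (ENNReal.mul_ne_top ENNReal.ofNat_ne_top (ENNReal.pow_ne_top ENNReal.ofReal_ne_top)) h4
  rwa [ENNReal.toReal_mul, ENNReal.toReal_pow, ENNReal.toReal_ofReal (by positivity),
    ENNReal.toReal_ofNat] at h5

variable [BorelSpace X]

theorem IsRegularSet.ae_tendsto (hE : IsRegularSet m E) :
    ∀ᵐ a ∂(μH[(m : ℝ)] : Measure X).restrict E, Tendsto (fun r : ℝ =>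
      (μH[(m : ℝ)] : Measure X).restrict E (Metric.ball a r) / ENNReal.ofReal (2 * r) ^ m)
      (𝓝[>] 0) (𝓝 1) := by
  rw [ae_restrict_iff'₀ hE.nullMeasurableSet]
  filter_upwards [hE.density_eq_one] with a ha haE
  simp only [Measure.restrict_apply Metric.isOpen_ball.measurableSet, Set.inter_comm _ E]
  exact ha haE

/-- Ball density one yields the doubling bound that makes each set of excessive convex density null;
countably many `δ` suffice. -/
theorem IsRegularSet.ae_upper_density [SecondCountableTopology X] (hE : IsRegularSet m E) :
    ∀ᵐ a ∂(μH[(m : ℝ)] : Measure X).restrict E, ∀ δ > 0, ∃ r₀ > 0, ∀ U : Set X, a ∈ U → ∀ D : ℝ,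
      0 < D → D < r₀ → (∀ p ∈ U, ∀ q ∈ U, dist p q ≤ D) →
      ((μH[(m : ℝ)] : Measure X).restrict E).real U ≤ (1 + δ) * D ^ m := by
  set μ := (μH[(m : ℝ)] : Measure X).restrict E with hμ
  have : IsFiniteMeasure μ := ⟨by rw [hμ, Measure.restrict_apply_univ]; exact hE.measure_lt_top⟩
  have key : ∀ j : ℕ, ∀ᵐ a ∂μ, a ∉ convexDensityExceeds μ m (1 / ((j : ℝ) + 1)) := by
    intro j
    set Z : Set X := {a | a ∈ E ∧ Tendsto (fun r : ℝ => μ (Metric.ball a r) /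
      ENNReal.ofReal (2 * r) ^ m) (𝓝[>] 0) (𝓝 1) ∧ a ∈ convexDensityExceeds μ m (1 / ((j : ℝ) + 1))}
      with hZ
    have hZ0 : (μH[(m : ℝ)] : Measure X) Z = 0 := by
      refine measure_convexDensityExceeds_eq_zero hE.measure_lt_top (δ := 1 / ((j : ℝ) + 1))
        (C := 2 * 8 ^ m) (by positivity) (fun a ha => ha.1) (fun a ha => ha.2.2) fun a ha => ?_
      obtain ⟨r₀, hr₀, h⟩ := exists_measureReal_ball_le_of_tendsto ha.2.1
      refine ⟨r₀ / 4, by positivity, fun r hr hrr => ?_⟩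
      calc μ.real (Metric.closedBall a (3 * r)) ≤ μ.real (Metric.ball a (4 * r)) :=
            measureReal_mono (Metric.closedBall_subset_ball (by linarith))
        _ ≤ 2 * (2 * (4 * r)) ^ m := h _ (by positivity) (by linarith)
        _ = 2 * 8 ^ m * r ^ m := by rw [← mul_assoc 2, mul_pow]; norm_num; ring
    have hZμ : μ Z = 0 := le_antisymm ((Measure.restrict_le_self Z).trans hZ0.le) zero_le
    filter_upwards [hE.ae_tendsto, ae_restrict_mem₀ hE.nullMeasurableSet,
      measure_eq_zero_iff_ae_notMem.1 hZμ] with a h1 h2 h3 h4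
    exact h3 ⟨h2, h1, h4⟩
  filter_upwards [ae_all_iff.2 key] with a ha δ hδ
  obtain ⟨j, hj⟩ := exists_nat_one_div_lt hδ
  have h := ha j
  simp only [convexDensityExceeds, Set.mem_ofPred_eq] at h
  push Not at h
  obtain ⟨r₀, hr₀, h⟩ := h
  refine ⟨r₀, hr₀, fun U haU D hD hDr hU => (h U D haU hD hDr hU).trans ?_⟩
  gcongr

end Regular

/-! ### Flatness under a linear change of norm -/

section Transfer

variable {X Y : Type*} [NormedAddCommGroup X] [NormedSpace ℝ X] [NormedAddCommGroup Y]
  [NormedSpace ℝ Y] {m : ℕ}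

/-- Flatness holds for every `ε`, so the distortion `M * M'` of `e` is absorbed in `ε`. -/
theorem IsFlatAt.image {F F' : Set X} (h : IsFlatAt m F F') (e : X ≃L[ℝ] Y) :
    IsFlatAt m (e '' F) (e '' F') := by
  obtain ⟨M, hM, heM⟩ := (e : X →L[ℝ] Y).bound
  obtain ⟨M', hM', heM'⟩ := (e.symm : Y →L[ℝ] X).bound
  have heM : ∀ x, ‖e x‖ ≤ M * ‖x‖ := heM
  have hinv : ∀ x, ‖x‖ ≤ M' * ‖e x‖ := fun x => by simpa using heM' (e x)
  intro ε hε
  obtain ⟨r₀, hr₀, hflat⟩ := h (ε / (M * M')) (by positivity)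
  have key : ∀ v : X, ∀ r, ‖v‖ ≤ ε / (M * M') * (M' * r) → ‖e v‖ ≤ ε * r := fun v r hv => by
    refine (heM v).trans ((mul_le_mul_of_nonneg_left hv hM.le).trans (le_of_eq ?_))
    field_simp
  refine ⟨r₀ / M', by positivity, ?_⟩
  rintro _ ⟨x, hx, rfl⟩ r hr hrr
  rw [lt_div_iff₀ hM', mul_comm] at hrr
  obtain ⟨W, hW, h1, h2⟩ := hflat x hx (M' * r) (by positivity) hrr
  refine ⟨W.map (e : X ≃ₗ[ℝ] Y).toLinearMap, ?_, ?_, ?_⟩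
  · rw [← hW]
    exact LinearEquiv.finrank_map_eq (e : X ≃ₗ[ℝ] Y) W
  · rintro _ ⟨y, hy, rfl⟩ hyr
    rw [← map_sub] at hyr
    obtain ⟨w, hw, hyw⟩ := h1 y hy ((hinv _).trans (by gcongr))
    refine ⟨e w, ⟨w, hw, rfl⟩, ?_⟩
    rw [← map_sub, ← map_sub]
    exact key _ _ hyw
  · rintro _ ⟨w, hw, rfl⟩ hwr
    obtain ⟨q, hq, hqw⟩ := h2 w hw ((hinv _).trans (by gcongr; exact hwr))
    refine ⟨e q, ⟨q, hq, rfl⟩, ?_⟩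
    have e1 : e q - e x - (e : X ≃ₗ[ℝ] Y).toLinearMap w = e (q - x - w) := by
      rw [map_sub, map_sub]; rfl
    rw [e1]
    exact key _ _ hqw

end Transfer

/-! ### Large projections in Euclidean coordinates -/

section Main

/-- In linear Euclidean coordinates, `F'` has almost full projections near each of its density
points. -/
theorem HasUniformDensity.exists_submodule_le_hausdorffMeasure_projection {X Y : Type*}
    [NormedAddCommGroup X] [NormedSpace ℝ X] [StrictConvexSpace ℝ X] [MeasurableSpace X]
    [BorelSpace X] [NormedAddCommGroup Y] [InnerProductSpace ℝ Y] [FiniteDimensional ℝ Y]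
    [MeasurableSpace Y] [BorelSpace Y] {m : ℕ} {μ : Measure X} [IsFiniteMeasure μ]
    (e : X ≃L[ℝ] Y) {F F' : Set X} (h : HasUniformDensity μ m F F') (hF' : IsCompact F') {a : X}
    (ha : a ∈ F') (hdens : ∀ δ > 0, ∃ r₀ > 0, ∀ r : ℝ, 0 < r → r < r₀ →
      μ.real (Metric.ball a r \ F') ≤ δ * r ^ m) {η : ℝ} (hη : 0 < η) (hη1 : η < 1 / 2) :
    ∃ r₀ > 0, ∀ r : ℝ, 0 < r → r < r₀ → ∃ V : Submodule ℝ Y, Module.finrank ℝ V = m ∧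
      ENNReal.ofReal (2 * ((1 - 2 * η) * r)) ^ m ≤
        μH[(m : ℝ)] ((fun p => V.starProjection (p - e a)) '' (e '' F' ∩ Metric.ball (e a) r)) +
          ENNReal.ofReal (η * r ^ m) := by
  have : FiniteDimensional ℝ X := e.symm.toLinearEquiv.finiteDimensional
  obtain ⟨M, hM, heM⟩ := (e : X →L[ℝ] Y).bound
  obtain ⟨M', hM', heM'⟩ := (e.symm : Y →L[ℝ] X).bound
  have heM : ∀ x, ‖e x‖ ≤ M * ‖x‖ := heM
  have hinv : ∀ x, ‖x‖ ≤ M' * ‖e x‖ := fun x => by simpa using heM' (e x)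
  have hem : Measurable e := e.continuous.measurable
  have hball : ∀ x : X, ∀ t : ℝ, e ⁻¹' Metric.ball (e x) t ⊆ Metric.ball x (M' * t) := by
    intro x t p hp
    rw [Set.mem_preimage, mem_ball_iff_norm, ← map_sub] at hp
    rw [mem_ball_iff_norm]
    exact (hinv _).trans_lt (mul_lt_mul_of_pos_left hp hM')
  have hball' : ∀ x : X, ∀ t : ℝ, Metric.ball x (t / M) ⊆ e ⁻¹' Metric.ball (e x) t := by
    intro x t p hp
    rw [mem_ball_iff_norm, lt_div_iff₀ hM, mul_comm] at hp
    rw [Set.mem_preimage, mem_ball_iff_norm, ← map_sub]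
    exact (heM _).trans_lt hp
  obtain ⟨r₁, hr₁, hlow⟩ := h.lower (1 / 2) (by norm_num)
  obtain ⟨r₂, hr₂, hup⟩ := h.upper 1 one_pos
  refine _root_.exists_submodule_le_hausdorffMeasure_projection (ν := μ.map e) (A := e '' F)
    (K := e '' F') (hF'.image e.continuous)
    (Set.image_mono h.subset) (c := (1 - 1 / 2) * (2 / M) ^ m) (C := (1 + 1) * (2 * M') ^ m)
    (r₁ := min (M * r₁) (r₂ / (2 * M'))) (by positivity) (by positivity) (by positivity)
    ?_ ?_ (h.isFlatAt.image e) ⟨a, ha, rfl⟩ ?_ hη hη1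
  · rintro _ ⟨x, hx, rfl⟩ t ht htr
    rw [map_measureReal_apply hem Metric.isOpen_ball.measurableSet]
    have h1 : t / M < r₁ := by
      rw [div_lt_iff₀ hM, mul_comm]; exact htr.trans_le (min_le_left _ _)
    refine le_trans (le_of_eq ?_) ((hlow x hx (t / M) (by positivity) h1).trans
      (measureReal_mono (hball' x t)))
    rw [mul_assoc, ← mul_pow]; ring
  · rintro _ ⟨x, hx, rfl⟩ t ht htr
    rw [map_measureReal_apply hem Metric.isOpen_ball.measurableSet]
    have h1 : 2 * (M' * t) < r₂ := by
      have := htr.trans_le (min_le_right _ _)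
      rw [lt_div_iff₀ (by positivity)] at this
      linarith
    refine (measureReal_mono (hball x t)).trans ((hup x hx _ (Metric.mem_ball_self (by positivity))
      (2 * (M' * t)) (by positivity) h1 fun p hp q hq => ?_).trans (le_of_eq ?_))
    · rw [Metric.mem_ball] at hp hq
      linarith [dist_triangle_right p q x]
    · rw [mul_assoc, ← mul_pow]; ring
  · intro δ hδ
    obtain ⟨r₃, hr₃, hd⟩ := hdens (δ / M' ^ m) (by positivity)
    refine ⟨r₃ / M', by positivity, fun t ht htr => ?_⟩
    rw [lt_div_iff₀ hM', mul_comm] at htr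
    rw [map_measureReal_apply hem
      (Metric.isOpen_ball.measurableSet.diff (hF'.image e.continuous).isClosed.measurableSet)]
    refine (measureReal_mono fun p hp => ?_).trans ((hd (M' * t) (by positivity) htr).trans
      (le_of_eq ?_))
    · exact ⟨hball a t hp.1, fun hpF => hp.2 ⟨p, hpF, rfl⟩⟩
    · rw [mul_pow]; field_simp

/-- The plane is `a + V`; its projection differs from the linear one only by a translation. -/
theorem exists_planesThrough_hausdorffMeasure_image_le {d m : ℕ} (a : EuclideanSpace ℝ (Fin d))
    (V : Submodule ℝ (EuclideanSpace ℝ (Fin d))) (hV : Module.finrank ℝ V = m)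
    {S T : Set (EuclideanSpace ℝ (Fin d))} (hST : S ⊆ T) :
    ∃ W : PlanesThrough a m, μH[(m : ℝ)] ((fun p => V.starProjection (p - a)) '' S) ≤
      μH[(m : ℝ)] (W.proj '' T) := by
  let W : PlanesThrough a m := ⟨AffineSubspace.mk' a V, AffineSubspace.self_mem_mk' a V, by
    rw [AffineSubspace.direction_mk']; exact hV⟩
  have hproj : ∀ p, W.proj p = V.starProjection (p - a) + a := by
    intro p
    have hne : Nonempty W.1 := ⟨⟨a, W.2.1⟩⟩
    refine EuclideanGeometry.coe_orthogonalProjection_eq_iff_mem.2 ⟨?_, ?_⟩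
    · rw [AffineSubspace.mem_mk', vsub_eq_sub, add_sub_cancel_right]
      exact V.starProjection_apply_mem (p - a)
    · rw [AffineSubspace.direction_mk', vsub_eq_sub,
        show p - (V.starProjection (p - a) + a) = p - a - V.starProjection (p - a) by abel]
      exact Submodule.sub_starProjection_mem_orthogonal (p - a)
  refine ⟨W, ?_⟩
  have h1 : W.proj '' S =
      IsometryEquiv.addRight a '' ((fun p => V.starProjection (p - a)) '' S) := by
    rw [Set.image_image]
    exact Set.image_congr fun p _ => hproj p
  rw [← (IsometryEquiv.addRight a).hausdorffMeasure_image, ← h1]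
  exact measure_mono (Set.image_mono hST)

theorem one_le_liminf_of_forall_eventually_le {m : ℕ} {f : ℝ → ℝ≥0∞}
    (h : ∀ η : ℝ, 0 < η → η < 1 / 2 →
      ∀ᶠ r in 𝓝[>] (0 : ℝ), ENNReal.ofReal ((1 - 2 * η) ^ m - η / 2 ^ m) ≤ f r) :
    1 ≤ liminf f (𝓝[>] 0) := by
  have h1 : Tendsto (fun η : ℝ => ENNReal.ofReal ((1 - 2 * η) ^ m - η / 2 ^ m)) (𝓝[>] 0) (𝓝 1) := by
    have h2 : Continuous fun η : ℝ => ENNReal.ofReal ((1 - 2 * η) ^ m - η / 2 ^ m) :=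
      ENNReal.continuous_ofReal.comp (by fun_prop)
    have h3 := h2.tendsto 0
    simp only [mul_zero, sub_zero, one_pow, zero_div, ENNReal.ofReal_one] at h3
    exact h3.mono_left nhdsWithin_le_nhds
  refine le_of_tendsto h1 ?_
  filter_upwards [Ioo_mem_nhdsGT (show (0 : ℝ) < 1 / 2 by norm_num)] with η hη
  exact le_liminf_of_le (by isBoundedDefault) (h η hη.1 hη.2)

theorem HasUniformDensity.one_le_liminf {X : Type*} [NormedAddCommGroup X] [NormedSpace ℝ X]
    [StrictConvexSpace ℝ X] [MeasurableSpace X] [BorelSpace X] {d m : ℕ} {μ : Measure X}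
    [IsFiniteMeasure μ] (e : X ≃L[ℝ] EuclideanSpace ℝ (Fin d)) {E F F' : Set X} (hFE : F ⊆ E)
    (h : HasUniformDensity μ m F F') (hF' : IsCompact F') {a : X}
    (ha : a ∈ F') (hdens : ∀ δ > 0, ∃ r₀ > 0, ∀ r : ℝ, 0 < r → r < r₀ →
      μ.real (Metric.ball a r \ F') ≤ δ * r ^ m) :
    (1 : ℝ≥0∞) ≤ liminf
      (fun r : ℝ => ⨆ V : PlanesThrough (e a) m,
        (μH[(m : ℝ)] : Measure (EuclideanSpace ℝ (Fin d)))
          (V.proj '' (e '' E ∩ Metric.ball (e a) r)) / ENNReal.ofReal (2 * r) ^ m)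
      (𝓝[>] 0) := by
  refine one_le_liminf_of_forall_eventually_le (m := m) fun η hη hη1 => ?_
  obtain ⟨r₀, hr₀, hr⟩ := h.exists_submodule_le_hausdorffMeasure_projection e hF' ha hdens hη hη1
  filter_upwards [Ioo_mem_nhdsGT hr₀] with r hrr
  have hr0 : 0 < r := hrr.1
  obtain ⟨V, hV, hle⟩ := hr r hrr.1 hrr.2
  obtain ⟨W, hW⟩ := exists_planesThrough_hausdorffMeasure_image_le (e a) V hV
    (Set.inter_subset_inter_left (Metric.ball (e a) r) (Set.image_mono (h.subset.trans hFE)))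
  refine le_iSup_of_le W ?_
  rw [ENNReal.le_div_iff_mul_le
    (Or.inl (pow_ne_zero _ (by simpa using hr0))) (Or.inl (ENNReal.pow_ne_top ENNReal.ofReal_ne_top)),
    ← ENNReal.ofReal_pow (by positivity), ← ENNReal.ofReal_mul' (by positivity)]
  have h1 : ((1 - 2 * η) ^ m - η / 2 ^ m) * (2 * r) ^ m =
      (2 * ((1 - 2 * η) * r)) ^ m - η * r ^ m := by
    simp only [mul_pow]
    field_simp
  rw [h1, ENNReal.ofReal_sub _ (by positivity), tsub_le_iff_right,
    ENNReal.ofReal_pow (by have : 0 < 1 - 2 * η := by linarith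
                           positivity)]
  exact hle.trans (by gcongr)

end Main

theorem mainTheorem6 {X : Type*} [NormedAddCommGroup X] [NormedSpace ℝ X] [StrictConvexSpace ℝ X]
    [MeasurableSpace X] [BorelSpace X] (d m : ℕ)
    -- linear coordinates that identify `X` with `ℝ^d` carrying the norm of `X`
    (e : X ≃ₗ[ℝ] EuclideanSpace ℝ (Fin d))
    (E : Set X) (hE : IsRegularSet m E) :
    ∀ᵐ a ∂(μH[(m : ℝ)] : Measure X), a ∈ E →
      (1 : ℝ≥0∞) ≤ liminf
        (fun r : ℝ => ⨆ V : PlanesThrough (e a) m,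
          (μH[(m : ℝ)] : Measure (EuclideanSpace ℝ (Fin d)))
            (V.proj '' (e '' E ∩ Metric.ball (e a) r)) / ENNReal.ofReal (2 * r) ^ m)
        (𝓝[>] 0) := by
  have : FiniteDimensional ℝ X := e.symm.finiteDimensional
  have : ProperSpace X := FiniteDimensional.proper ℝ X
  rw [← ae_restrict_iff'₀ hE.nullMeasurableSet]
  set μ := (μH[(m : ℝ)] : Measure X).restrict E with hμ
  have : IsFiniteMeasure μ := ⟨by rw [hμ, Measure.restrict_apply_univ]; exact hE.measure_lt_top⟩
  have hEc : μ Eᶜ = 0 := mem_ae_iff.1 (ae_restrict_mem₀ hE.nullMeasurableSet)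
  have hlow : ∀ᵐ x ∂μ, ∀ δ > 0, ∃ r₀ > 0, ∀ r : ℝ, 0 < r → r < r₀ →
      (1 - δ) * (2 * r) ^ m ≤ μ.real (Metric.ball x r) := by
    filter_upwards [hE.ae_tendsto] with x hx δ hδ
    exact exists_lower_density_of_tendsto hx hδ
  rw [ae_iff]
  by_contra hbad
  -- If the bad set had positive measure, `F'` could be chosen to miss at most half that measure;
  -- but almost every point of `F'` is a density point of it, hence good, so almost all bad points
  -- lie off `F'`.
  obtain ⟨F, F', hFE, hF', h, hle⟩ := exists_isCompact_hasUniformDensity hEc hlow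
    hE.ae_upper_density (ENNReal.half_pos hbad).ne'
  have hdens : ∀ᵐ a ∂μ, ∀ j : ℕ, a ∈ F' → ∃ r₀ > 0, ∀ r : ℝ, 0 < r → r < r₀ →
      μ.real (Metric.ball a r \ F') ≤ 1 / ((j : ℝ) + 1) * r ^ m := by
    refine ae_all_iff.2 fun j => ae_measureReal_ball_diff_le hF'.isClosed.measurableSet ?_
      (by positivity)
    intro x hx δ hδ
    obtain ⟨r₀, hr₀, h1⟩ := h.upper δ hδ
    exact ⟨r₀, hr₀, h1 x (h.subset hx)⟩
  refine (ENNReal.half_lt_self hbad (measure_ne_top μ _)).not_ge (le_trans ?_ hle)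
  refine measure_mono_ae ?_
  filter_upwards [hdens] with a ha hna haF
  refine hna (h.one_le_liminf e.toContinuousLinearEquiv hFE hF' haF fun δ hδ => ?_)
  obtain ⟨j, hj⟩ := exists_nat_one_div_lt hδ
  obtain ⟨r₀, hr₀, h1⟩ := ha j haF
  exact ⟨r₀, hr₀, fun r hr hrr => (h1 r hr hrr).trans (by gcongr)⟩
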